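/- Let $s,r,\ell\ge 1$ be integers with $\gcd(s,\ell)=1$ and $r$ even, and let $a,b>0$ be real. For $\lambda>0$, $0\le j<s$ and $h\in\mathbb{R}$ put $$Z_{\lambda,j}(h)=\lambda a\cos\frac{rh+2\pi j}{s}+\mathrm{i}\,\frac{\lambda b}{\ell}\sin\frac{\ell(rh+2\pi j)}{s}.$$ The product $\prod_{j=0}^{s-1}(u-Z_{\lambda,j}(h))$ is a polynomial in $u$, $e^{\mathrm{i}h}$, $e^{-\mathrm{i}h}$; let $f_\lambda(u,v,\overline v)$ be the polynomial obtained by expanding it, with no product $e^{\mathrm{i}h}e^{-\mathrm{i}h}$ left, and writing $v$ for $e^{\mathrm{i}h}$ and $\overline v$ for $e^{-\mathrm{i}h}$. We write $f_\lambda(u,v)$ for its value, and $\deg f_\lambda$ for its total degree in $u,v,\overline v$. Let $L(s,r,\ell)$ be the lemniscate link, i.e. the closure of the braid with the strands $(X_j(h),Y_j(h),h)$, $0\le j<s$, $0\le h\le 2\pi$, where $X_j(h)=a'\cos\frac{rh+2\pi j}{s}$ and $Y_j(h)=\frac{b'}{\ell}\sin\frac{\ell(rh+2\pi j)}{s}$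 with any $a',b'>0$. As a subset of $\mathbb{R}^3$ it is $$\{(\cos h\,(R+X_j(h)),\ \sin h\,(R+X_j(h)),\ Y_j(h)) : 0\le j<s,\ 0\le h\le 2\pi\}$$ with any $R>a'$. It is carried to the unit sphere of $\mathbb{C}^2$ by inverse stereographic projection $u=\frac{|x|^2-1+2\mathrm{i}x_3}{|x|^2+1}$, $v=\frac{2(x_1+\mathrm{i}x_2)}{|x|^2+1}$, and to the sphere of radius $\delta$ by scaling. For $(u,v)\in\mathbb{C}^2\setminus\{0\}$ let $\rho=\sqrt{|u|^2+|v|^2}$ and $$F(u,v)=\rho^{\deg f_\rho}f_\rho\left(\frac u\rho,\frac v\rho\right).$$ Then $F(u,v)=\rho^{s+\deg f_\rho}f_1\left(\frac{u}{\rho^2},\frac v\rho\right)$, and there are an integer $n\ge 0$ and a real polynomial map $P:\mathbb{R}^4\to\mathbb{R}^2$, in the coordinates $\mathrm{Re}\,u,\mathrm{Im}\,u,\mathrm{Re}\,v,\mathrm{Im}\,v$, such that 1. $P=\rho^nF$ on $\mathbb{C}^2\setminus\{0\}$, where $\mathbb{R}^2=\mathbb{C}$; 2. $P$ has a weakly isolated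 singularity at the origin: $P(0)=0$, the Jacobian of $P$ at $0$ has rank less than $2$, and in some neighbourhood of $0$ there is no other zero of $P$ at which the Jacobian has rank less than $2$; 3. there is an $\varepsilon>0$ such that for every $0<\delta<\varepsilon$ the intersection of $P^{-1}(0)$ with the sphere of radius $\delta$ about $0$ is the link $L(s,r,\ell)$, i.e. it is carried to $L(s,r,\ell)$ by an ambient isotopy of that sphere. -/

import Mathlib

open scoped Topology

/-! ### The lemniscate braid and its closure -/

/-- The phase `(r h + 2π j)/s` of the strand `j = 0, …, s-1` at height `h`. -/
noncomputable def strandPhase (s r j : ℕ) (h : ℝ) : ℝ :=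
  (r * h + 2 * Real.pi * j) / s

/-- First horizontal coordinate `a cos((r h + 2π j)/s)` of a strand. -/
noncomputable def strandX (a : ℝ) (s r j : ℕ) (h : ℝ) : ℝ :=
  a * Real.cos (strandPhase s r j h)

/-- Second horizontal coordinate `(b/ℓ) sin(ℓ (r h + 2π j)/s)` of a strand. -/
noncomputable def strandY (b : ℝ) (s r l j : ℕ) (h : ℝ) : ℝ :=
  b / l * Real.sin (l * strandPhase s r j h)

/-- The strand position as a complex number, `Z_j(h) = X_j(h) + i Y_j(h)`. -/
noncomputable def strandZ (a b : ℝ) (s r l j : ℕ) (h : ℝ) : ℂ :=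
  ⟨strandX a s r j h, strandY b s r l j h⟩

/-- The lemniscate link in `ℝ³`: the closure of the lemniscate braid, in a cylinder of radius `R`
wrapped around the `z`-axis, `h` being the azimuth. (For `R > a` the strands stay off the axis.) -/
def closedBraid (a b R : ℝ) (s r l : ℕ) : Set (ℝ × ℝ × ℝ) :=
  {p | ∃ j < s, ∃ h ∈ Set.Icc 0 (2 * Real.pi),
    p = (Real.cos h * (R + strandX a s r j h), Real.sin h * (R + strandX a s r j h),
      strandY b s r l j h)}

/-- Inverse stereographic projection `ℝ³ → S³ ⊆ ℂ²`,
`u = (|x|² - 1 + 2 i z)/(|x|² + 1)`, `v = 2 (x + i y)/(|x|² + 1)`. -/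
noncomputable def invStereo (p : ℝ × ℝ × ℝ) : ℂ × ℂ :=
  let q : ℝ := p.1 ^ 2 + p.2.1 ^ 2 + p.2.2 ^ 2
  (⟨(q - 1) / (q + 1), 2 * p.2.2 / (q + 1)⟩, ⟨2 * p.1 / (q + 1), 2 * p.2.1 / (q + 1)⟩)

/-- The Euclidean norm `ρ = √(|u|² + |v|²)` on `ℂ² = ℝ⁴`. -/
noncomputable def rho (u v : ℂ) : ℝ := Real.sqrt (‖u‖ ^ 2 + ‖v‖ ^ 2)

/-- The three-sphere of radius `δ` about the origin of `ℂ²`. -/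
def sphere3 (δ : ℝ) : Set (ℂ × ℂ) := {p | rho p.1 p.2 = δ}

/-- The lemniscate link transported to the three-sphere of radius `δ`. -/
noncomputable def lemniscateLink (δ a b R : ℝ) (s r l : ℕ) : Set (ℂ × ℂ) :=
  (fun p => ((δ : ℂ) * (invStereo p).1, (δ : ℂ) * (invStereo p).2)) '' closedBraid a b R s r l

/-- `A ∩ S` and `B ∩ S` are ambient isotopic in the space `S`: a continuous path of
self-homeomorphisms of `S` starting at the identity ends at one taking `A ∩ S` onto `B ∩ S`. -/
def AmbientIsotopicIn {E : Type*} [TopologicalSpace E] (S A B : Set E) : Prop :=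
  ∃ H : unitInterval → (S ≃ₜ S),
    Continuous (fun q : unitInterval × S => H q.1 q.2) ∧
    H 0 = Homeomorph.refl S ∧
    H 1 '' {x : S | (x : E) ∈ A} = {x : S | (x : E) ∈ B}

/-! ### The semiholomorphic polynomial of the braid -/

section BraidPolynomial

open LaurentPolynomial

/-- The root of unity `exp(2π i/s)`. -/
noncomputable def unityRoot (s : ℕ) : ℂ := Complex.exp (2 * Real.pi * Complex.I / s)

/-- The root `Z_j` as a Laurent polynomial in `T = exp(i h/s)`, by Euler's formulas;
`w` stands for `exp(2π i j/s)`. -/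
noncomputable def laurentRoot (a b : ℝ) (r l : ℕ) (w : ℂ) : LaurentPolynomial ℂ :=
  C ((a : ℂ) / 2 * w) * T r + C ((a : ℂ) / 2 * w⁻¹) * T (-r)
    + C ((b : ℂ) / (2 * l) * w ^ l) * T (l * r) - C ((b : ℂ) / (2 * l) * (w ^ l)⁻¹) * T (-(l * r))

/-- The polynomial `∏_j (u - Z_j)` in `u`, with coefficients in `ℂ[T, T⁻¹]`, `T = exp(i h/s)`. -/
noncomputable def laurentBraidPoly (a b : ℝ) (s r l : ℕ) : Polynomial (LaurentPolynomial ℂ) :=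
  ∏ j ∈ Finset.range s, (Polynomial.X - Polynomial.C (laurentRoot a b r l (unityRoot s ^ j)))

/-- The polynomial `f` in the variables `u = X 0`, `v = X 1`, `v̄ = X 2`: in the expanded braid
polynomial each power `T ^ n = exp(i h n/s)` is replaced by `v ^ (n/s)` if `n ≥ 0` and by
`v̄ ^ (-n/s)` if `n ≤ 0`. (All `n` that occur are divisible by `s`: `dvd_of_coeff_ne_zero`.) -/
noncomputable def braidPoly (a b : ℝ) (s r l : ℕ) : MvPolynomial (Fin 3) ℂ :=
  ∑ k ∈ Finset.range (s + 1), (((laurentBraidPoly a b s r l).coeff k).coeff).sum fun n c =>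
    MvPolynomial.C c * MvPolynomial.X 0 ^ k * MvPolynomial.X 1 ^ (n / s).toNat
      * MvPolynomial.X 2 ^ (-(n / s)).toNat

lemma unityRoot_pow (s : ℕ) (hs : 0 < s) : unityRoot s ^ s = 1 := by
  have : (s : ℂ) ≠ 0 := by exact_mod_cast hs.ne'
  rw [unityRoot, ← Complex.exp_nat_mul, mul_div_cancel₀ _ this, Complex.exp_two_pi_mul_I]

lemma prod_range_shift {M : Type*} [CommMonoid M] (g : ℕ → M) (s : ℕ)
    (hg : ∀ j, g (j + s) = g j) (m : ℕ) :
    ∏ j ∈ Finset.range s, g (j + m) = ∏ j ∈ Finset.range s, g j := by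
  induction m with
  | zero => rfl
  | succ m ih =>
    rw [← ih]
    cases s with
    | zero => rfl
    | succ t =>
      rw [Finset.prod_range_succ, Finset.prod_range_succ']
      have h1 := hg m
      congr 1
      · refine Finset.prod_congr rfl fun j _ => ?_
        congr 1; omega
      · rw [← hg (0 + m)]; congr 1; omega

/-- The substitution `T ↦ ω T` in Laurent polynomials. -/
noncomputable def twist (w : ℂˣ) : LaurentPolynomial ℂ →+* LaurentPolynomial ℂ :=
  eval₂ (C : ℂ →+* LaurentPolynomial ℂ)
    (Units.map (C : ℂ →+* LaurentPolynomial ℂ).toMonoidHom w * (isUnit_T 1).unit)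

lemma twist_C_mul_T (w : ℂˣ) (c : ℂ) (n : ℤ) :
    twist w (C c * T n) = C (c * (w : ℂ) ^ n) * T n := by
  have hT : (((isUnit_T (R := ℂ) 1).unit ^ n : (LaurentPolynomial ℂ)ˣ) : LaurentPolynomial ℂ)
      = T n := by
    have key : ∀ m : ℕ, (((isUnit_T (R := ℂ) 1).unit ^ m : (LaurentPolynomial ℂ)ˣ) :
        LaurentPolynomial ℂ) = T m := by
      intro m
      rw [Units.val_pow_eq_pow_val, IsUnit.unit_spec, T_pow, mul_one]
    rcases Int.eq_nat_or_neg n with ⟨m, rfl | rfl⟩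
    · rw [zpow_natCast, key]
    · rw [zpow_neg, zpow_natCast, Units.inv_eq_of_mul_eq_one_right]
      rw [key, ← T_add, add_neg_cancel, T_zero]
  have hC : ((Units.map (C : ℂ →+* LaurentPolynomial ℂ).toMonoidHom w ^ n :
      (LaurentPolynomial ℂ)ˣ) : LaurentPolynomial ℂ) = C ((w : ℂ) ^ n) := by
    rw [← map_zpow, ← Units.val_zpow_eq_zpow_val]; rfl
  rw [twist, eval₂_C_mul_T, mul_zpow, Units.val_mul, hT, hC, map_mul, mul_assoc]

lemma laurent_eq_sum (p : LaurentPolynomial ℂ) :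
    p = p.coeff.sum fun n c => C c * T n := by
  induction p using LaurentPolynomial.induction_on' with
  | add p q hp hq =>
    conv_lhs => rw [hp, hq]
    rw [AddMonoidAlgebra.coeff_add, Finsupp.sum_add_index']
    · simp
    · intros; simp [add_mul]
  | C_mul_T n a =>
    rw [← single_eq_C_mul_T, AddMonoidAlgebra.coeff_single, Finsupp.sum_single_index]
    · rw [single_eq_C_mul_T]
    · simp

lemma twist_coeff (w : ℂˣ) (p : LaurentPolynomial ℂ) (n : ℤ) :
    (twist w p).coeff n = p.coeff n * (w : ℂ) ^ n := by
  induction p using LaurentPolynomial.induction_on' with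
  | add p q hp hq => simp [hp, hq, add_mul]
  | C_mul_T m a =>
    rw [twist_C_mul_T, ← single_eq_C_mul_T, ← single_eq_C_mul_T, AddMonoidAlgebra.coeff_single,
      AddMonoidAlgebra.coeff_single, Finsupp.single_apply, Finsupp.single_apply]
    split_ifs with h
    · rw [h]
    · simp

/-- Only powers of `T ^ s = exp(i h)` occur in the expanded braid polynomial. -/
theorem dvd_of_coeff_ne_zero (a b : ℝ) (s r l : ℕ) (hs : 0 < s) (k : ℕ) (n : ℤ)
    (hn : ((laurentBraidPoly a b s r l).coeff k).coeff n ≠ 0) : (s : ℤ) ∣ n := by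
  have hw : unityRoot s ≠ 0 := Complex.exp_ne_zero _
  have hp : IsPrimitiveRoot (unityRoot s) s := Complex.isPrimitiveRoot_exp s hs.ne'
  set w : ℂˣ := Units.mk0 (unityRoot s) hw with hwdef
  have hroot : ∀ j, twist w (laurentRoot a b r l (unityRoot s ^ j))
      = laurentRoot a b r l (unityRoot s ^ (j + r)) := by
    intro j
    simp only [laurentRoot, map_add, map_sub, twist_C_mul_T, hwdef, Units.val_mk0]
    have e1 : unityRoot s ^ (l * r : ℤ) = (unityRoot s ^ r) ^ l := by
      rw [← pow_mul, mul_comm r l]; exact_mod_cast zpow_natCast (unityRoot s) (l * r)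
    simp only [zpow_neg, e1, zpow_natCast, pow_add, mul_pow, mul_inv, mul_assoc]
  have hinv : (laurentBraidPoly a b s r l).map (twist w) = laurentBraidPoly a b s r l := by
    rw [laurentBraidPoly, Polynomial.map_prod]
    simp only [Polynomial.map_sub, Polynomial.map_X, Polynomial.map_C, hroot]
    exact prod_range_shift (fun j => Polynomial.X - Polynomial.C
      (laurentRoot a b r l (unityRoot s ^ j))) s
      (fun j => by simp only [pow_add, unityRoot_pow s hs, mul_one]) r
  have h1 : twist w ((laurentBraidPoly a b s r l).coeff k)
      = (laurentBraidPoly a b s r l).coeff k := by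
    rw [← Polynomial.coeff_map, hinv]
  have h2 := twist_coeff w ((laurentBraidPoly a b s r l).coeff k) n
  rw [h1] at h2
  have h3 : (unityRoot s) ^ n = 1 := by
    have := mul_left_cancel₀ hn ((mul_one _).trans h2)
    simpa [hwdef] using this.symm
  exact (hp.zpow_eq_one_iff_dvd n).mp h3

/-- On `|v| = 1` the polynomial `braidPoly` is the braid polynomial `∏_j (u - Z_j(h))`. -/
theorem eval_braidPoly (a b : ℝ) (s r l : ℕ) (hs : 0 < s) (u : ℂ) (h : ℝ) :
    MvPolynomial.eval ![u, Complex.exp (Complex.I * h), Complex.exp (-(Complex.I * h))]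
      (braidPoly a b s r l) = ∏ j ∈ Finset.range s, (u - strandZ a b s r l j h) := by
  have hs0 : (s : ℂ) ≠ 0 := by exact_mod_cast hs.ne'
  set t : ℂˣ := Units.mk0 (Complex.exp (Complex.I * h / s)) (Complex.exp_ne_zero _) with ht
  set φ : LaurentPolynomial ℂ →+* ℂ := eval₂ (RingHom.id ℂ) t with hφ
  have hz : ∀ j, φ (laurentRoot a b r l (unityRoot s ^ j)) = strandZ a b s r l j h := by
    intro j
    have e1 : unityRoot s ^ j * Complex.exp (Complex.I * h / s) ^ r
        = Complex.exp (strandPhase s r j h * Complex.I) := by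
      rw [unityRoot, ← Complex.exp_nat_mul, ← Complex.exp_nat_mul, ← Complex.exp_add]
      congr 1
      simp only [strandPhase]; push_cast; field_simp; ring
    have e2 : Complex.exp (Complex.I * h / s) ^ (l * r : ℤ)
        = (Complex.exp (Complex.I * h / s) ^ r) ^ l := by
      rw [← pow_mul, mul_comm r l]
      exact_mod_cast zpow_natCast (Complex.exp (Complex.I * h / s)) (l * r)
    have e3 : strandZ a b s r l j h = a * Complex.cos (strandPhase s r j h)
        + b / l * Complex.sin (l * strandPhase s r j h) * Complex.I := by
      rw [strandZ, Complex.mk_eq_add_mul_I, strandX, strandY]; push_cast; rfl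
    simp only [laurentRoot, map_add, map_sub, hφ, eval₂_C_mul_T, RingHom.id_apply, ht,
      Units.val_zpow_eq_zpow_val, Units.val_mk0]
    simp only [zpow_neg, e2, zpow_natCast]
    rw [e3, Complex.cos, Complex.sin,
      show (l : ℂ) * strandPhase s r j h * Complex.I = l * (strandPhase s r j h * Complex.I) by ring,
      show -((l : ℂ) * strandPhase s r j h) * Complex.I
        = -(l * (strandPhase s r j h * Complex.I)) by ring,
      show -(strandPhase s r j h : ℂ) * Complex.I = -(strandPhase s r j h * Complex.I) by ring,
      Complex.exp_neg, Complex.exp_neg, Complex.exp_nat_mul, ← e1]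
    simp only [mul_pow, mul_inv]
    have hI : Complex.I * Complex.I = -1 := Complex.I_mul_I
    linear_combination (-(b / (2 * l) * (((unityRoot s ^ j) ^ l)⁻¹
      * ((Complex.exp (Complex.I * h / s) ^ r) ^ l)⁻¹
      - (unityRoot s ^ j) ^ l * (Complex.exp (Complex.I * h / s) ^ r) ^ l)) : ℂ) * hI
  have hmap : (laurentBraidPoly a b s r l).map φ
      = ∏ j ∈ Finset.range s, (Polynomial.X - Polynomial.C (strandZ a b s r l j h)) := by
    rw [laurentBraidPoly, Polynomial.map_prod]
    simp only [Polynomial.map_sub, Polynomial.map_X, Polynomial.map_C, hz]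
  have heval : ∏ j ∈ Finset.range s, (u - strandZ a b s r l j h)
      = ((laurentBraidPoly a b s r l).map φ).eval u := by
    rw [hmap, Polynomial.eval_prod]; simp
  have hdeg : ((laurentBraidPoly a b s r l).map φ).natDegree < s + 1 := by
    rw [hmap, Polynomial.natDegree_prod_of_monic _ _ fun j _ => Polynomial.monic_X_sub_C _]
    simp
  rw [heval, Polynomial.eval_eq_sum_range' hdeg, braidPoly, map_sum]
  refine Finset.sum_congr rfl fun k _ => ?_
  rw [Polynomial.coeff_map]
  conv_rhs => rw [laurent_eq_sum ((laurentBraidPoly a b s r l).coeff k)]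
  rw [Finsupp.sum, Finsupp.sum, map_sum, map_sum, Finset.sum_mul]
  refine Finset.sum_congr rfl fun n hn => ?_
  obtain ⟨m, rfl⟩ := dvd_of_coeff_ne_zero a b s r l hs k n (Finsupp.mem_support_iff.mp hn)
  have hs1 : (s : ℤ) ≠ 0 := by exact_mod_cast hs.ne'
  have hpow : Complex.exp (Complex.I * h) ^ m.toNat * Complex.exp (-(Complex.I * h)) ^ (-m).toNat
      = Complex.exp (Complex.I * h / s) ^ ((s : ℤ) * m) := by
    rw [zpow_mul, zpow_natCast, ← Complex.exp_nat_mul (Complex.I * h / s), mul_div_cancel₀ _ hs0]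
    rcases Int.eq_nat_or_neg m with ⟨q, rfl | rfl⟩
    · simp
    · simp [Complex.exp_neg]
  simp only [Int.mul_ediv_cancel_left _ hs1, map_mul, map_pow, MvPolynomial.eval_C,
    MvPolynomial.eval_X, hφ, eval₂_C, eval₂_T, RingHom.id_apply, ht, Units.val_zpow_eq_zpow_val,
    Units.val_mk0, ← hpow]
  simp
  ring

end BraidPolynomial

/-- The value `f(u, v, v̄)` of the braid polynomial with stretching factors `a`, `b`. -/
noncomputable def braidFun (a b : ℝ) (s r l : ℕ) (u v : ℂ) : ℂ :=
  MvPolynomial.eval ![u, v, (starRingEnd ℂ) v] (braidPoly a b s r l)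

/-- The rescaled function `F(u, v) = ρ^{deg f_ρ} f_ρ(u/ρ, v/ρ)`, where `ρ = |(u, v)|` and `f_ρ` has
the stretching factors `ρ a`, `ρ b`. -/
noncomputable def rescaledFun (a b : ℝ) (s r l : ℕ) (u v : ℂ) : ℂ :=
  (rho u v : ℂ) ^ (braidPoly (rho u v * a) (rho u v * b) s r l).totalDegree
    * braidFun (rho u v * a) (rho u v * b) s r l (u / rho u v) (v / rho u v)

/-! ### Real polynomial maps `ℝ⁴ → ℝ²` and their singular points -/

/-- The real coordinates `(Re u, Im u, Re v, Im v)` on `ℂ²`. -/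
def realCoords (u v : ℂ) : Fin 4 → ℝ := ![u.re, u.im, v.re, v.im]

/-- The Jacobian matrix of a polynomial map `ℝ⁴ → ℝ²`. -/
noncomputable def polyJacobian (P : Fin 2 → MvPolynomial (Fin 4) ℝ) (x : Fin 4 → ℝ) :
    Matrix (Fin 2) (Fin 4) ℝ :=
  Matrix.of fun i j => MvPolynomial.eval x (MvPolynomial.pderiv j (P i))

/-- `x` is a singular point: the Jacobian does not have full rank at `x`. -/
def IsSingularPoint (P : Fin 2 → MvPolynomial (Fin 4) ℝ) (x : Fin 4 → ℝ) : Prop :=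
  (polyJacobian P x).rank < 2

/-- `x` belongs to the nodal set (the zero set) of `P`. -/
def IsNodalPoint (P : Fin 2 → MvPolynomial (Fin 4) ℝ) (x : Fin 4 → ℝ) : Prop :=
  ∀ i, MvPolynomial.eval x (P i) = 0

/-- `x` is a weakly isolated singularity: a singular point in the nodal set which, in some
neighbourhood of it, is the only such point. -/
def IsWeaklyIsolatedSingularity (P : Fin 2 → MvPolynomial (Fin 4) ℝ) (x : Fin 4 → ℝ) : Prop :=
  IsSingularPoint P x ∧ IsNodalPoint P x ∧
    ∀ᶠ y in 𝓝 x, IsSingularPoint P y → IsNodalPoint P y → y = x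

/-! ### Ambient isotopy is an equivalence relation -/

namespace AmbientIsotopicIn

variable {E : Type*} [TopologicalSpace E] {S A B D : Set E}

/-! The strands are linear in the stretching factors, so f_λ(u, v) = λ^s f_1(u/λ, v) and D = deg f_λ
is the same for all λ > 0; this gives the formula for F. A monomial of f_1 has degree k ≤ s in u and
degree m ≤ D in v and v̄ together. For even r the shift h ↦ h + π only permutes the strands, so m is
even (`even_of_coeff_ne_zero`). Hence in ρ^{2(s+D+1)} f_1(u/ρ², v/ρ) each monomial carries an even
nonnegative power of ρ, and the sum is a polynomial P (`exists_polyValue_eq`).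

On the sphere of radius δ put u = δ²z and v = δ√(1 - δ²|z|²) e^{ih}. There P is a nonzero constant
times G_t(z, h) with t = δ² (`braidDeform`). By evenness G_t is smooth in t, and G_0 = ∏ (z -
Z_j(h)), whose roots are simple because gcd(s, ℓ) = 1. For small t a Newton-type contraction yields
exactly one root near each Z_j(h), continuous in h (`SimpleRootFamily.exists_roots`). A Cauchy bound
and compactness exclude further roots (`norm_le_of_braidDeform_eq_zero`,
`exists_near_of_braidDeform_eq_zero`). At these roots the z-derivative of G_t is still invertible,
so P has full rank at every other zero near the origin.

For the isotopy, the sphere is a disc in the u-plane times the circle of arguments of v, with the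
circle collapsed over the boundary of the disc. Bijections of the disc that fix the boundary
therefore induce isotopies of the sphere (`ambientIsotopicIn_of_fiberwise`). Nearby strands are
carried to each other by bump fields, and a connected family of disjoint strands is handled by
chaining such small moves (`ambientIsotopicIn_of_homotopy`). This carries the zero set to the
strands δ²Z_j, these to the stereographic image of a thin closed braid, and that to any other model
of L(s, r, ℓ) (`ambientIsotopicIn_lemniscateLink`). -/

theorem symm (h : AmbientIsotopicIn S A B) : AmbientIsotopicIn S B A := by
  obtain ⟨H, hH, h0, h1⟩ := h
  -- Reversing time gives an isotopy that starts at `H 1`; precomposing with the inverse of `H 1`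
  -- makes it start at the identity.
  refine ⟨fun t => (H 1).symm.trans (H (unitInterval.symm t)), ?_, ?_, ?_⟩
  · exact hH.comp ((unitInterval.continuous_symm.comp continuous_fst).prodMk
      ((H 1).symm.continuous.comp continuous_snd))
  · simp
  · have : ⇑((H 1).symm.trans (H (unitInterval.symm 1))) = (H 1).symm := by
      ext x
      simp [h0]
    rw [this, ← h1, ← Set.image_comp]
    simp

theorem trans (h : AmbientIsotopicIn S A B) (k : AmbientIsotopicIn S B D) :
    AmbientIsotopicIn S A D := by
  obtain ⟨H, hH, h0, h1⟩ := h
  obtain ⟨K, hK, k0, k1⟩ := k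
  -- Composing at equal times avoids concatenation, as both isotopies start at the identity.
  refine ⟨fun t => (H t).trans (K t), hK.comp (continuous_fst.prodMk hH), ?_, ?_⟩
  · simp [h0, k0]
    rfl
  · rw [← k1, ← h1, Set.image_image]
    rfl

theorem congr_left {A' : Set E} (h : AmbientIsotopicIn S A B) (hA : ∀ x ∈ S, x ∈ A' ↔ x ∈ A) :
    AmbientIsotopicIn S A' B := by
  obtain ⟨H, hH, h0, h1⟩ := h
  refine ⟨H, hH, h0, ?_⟩
  rw [← h1]
  congr 1
  ext x
  exact hA x x.2

end AmbientIsotopicIn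

/-! ### Isotopies of the three-sphere that preserve the argument of the second coordinate -/

/-- The point of the three-sphere of radius `δ` with first coordinate `u` whose second coordinate
has argument `h`. -/
noncomputable def spherePoint (δ : ℝ) (u : ℂ) (h : ℝ) : ℂ × ℂ :=
  (u, (√(δ ^ 2 - ‖u‖ ^ 2) : ℝ) * Complex.exp (h * Complex.I))

/-- The set swept out in the three-sphere of radius `δ` by the strands `p j` in the disc. -/
def fiberedSet {ι : Type*} (δ : ℝ) (p : ι → ℝ → ℂ) : Set (ℂ × ℂ) :=
  {x | ∃ j h, x = spherePoint δ (p j h) h}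

theorem mem_sphere3_iff {δ : ℝ} (hδ : 0 ≤ δ) (x : ℂ × ℂ) :
    x ∈ sphere3 δ ↔ ‖x.1‖ ^ 2 + ‖x.2‖ ^ 2 = δ ^ 2 := by
  rw [sphere3, Set.mem_ofPred_eq, rho, Real.sqrt_eq_iff_eq_sq (by positivity) hδ]

theorem continuous_spherePoint (δ : ℝ) :
    Continuous fun q : ℂ × ℝ => spherePoint δ q.1 q.2 := by
  unfold spherePoint
  fun_prop

theorem spherePoint_mem {δ : ℝ} (hδ : 0 ≤ δ) {u : ℂ} (hu : ‖u‖ ≤ δ) (h : ℝ) :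
    spherePoint δ u h ∈ sphere3 δ := by
  have : 0 ≤ δ ^ 2 - ‖u‖ ^ 2 := by nlinarith [norm_nonneg u]
  rw [mem_sphere3_iff hδ, spherePoint]
  simp only [norm_mul, Complex.norm_real, Complex.norm_exp_ofReal_mul_I, mul_one, Real.norm_eq_abs,
    sq_abs, Real.sq_sqrt this]
  ring

theorem norm_fst_le_of_mem_sphere3 {δ : ℝ} (hδ : 0 ≤ δ) {x : ℂ × ℂ} (hx : x ∈ sphere3 δ) :
    ‖x.1‖ ≤ δ := by
  rw [mem_sphere3_iff hδ] at hx
  exact abs_le_of_sq_le_sq' (by nlinarith [sq_nonneg ‖x.2‖]) hδ |>.2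

/-- Where the second coordinate vanishes the conventional value of `arg` is harmless, since the
modulus √(δ² - ‖u‖²) is then 0. -/
theorem spherePoint_arg {δ : ℝ} (hδ : 0 ≤ δ) {x : ℂ × ℂ} (hx : x ∈ sphere3 δ) :
    spherePoint δ x.1 x.2.arg = x := by
  rw [mem_sphere3_iff hδ] at hx
  have : δ ^ 2 - ‖x.1‖ ^ 2 = ‖x.2‖ ^ 2 := by linarith
  refine Prod.ext rfl ?_
  rw [spherePoint, this, Real.sqrt_sq (norm_nonneg _), Complex.norm_mul_exp_arg_mul_I]

theorem spherePoint_add_two_pi (δ : ℝ) (u : ℂ) (h : ℝ) :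
    spherePoint δ u (h + 2 * Real.pi) = spherePoint δ u h := by
  simp only [spherePoint]
  push_cast
  rw [add_mul, Complex.exp_periodic]

theorem isCompact_sphere3 {δ : ℝ} (hδ : 0 ≤ δ) : IsCompact (sphere3 δ) := by
  have hc : IsClosed (sphere3 δ) := by
    have : Continuous fun p : ℂ × ℂ => rho p.1 p.2 := by unfold rho; fun_prop
    exact isClosed_singleton.preimage this
  refine (isCompact_closedBall (0 : ℂ × ℂ) δ).of_isClosed_subset hc fun x hx => ?_
  have h1 := norm_fst_le_of_mem_sphere3 hδ hx
  have h2 : ‖x.2‖ ≤ δ := by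
    rw [mem_sphere3_iff hδ] at hx
    exact abs_le_of_sq_le_sq' (by nlinarith [sq_nonneg ‖x.1‖]) hδ |>.2
  simpa [Prod.norm_def] using ⟨h1, h2⟩

theorem exists_Icc_add_int_mul (h : ℝ) :
    ∃ h₀ ∈ Set.Icc 0 (2 * Real.pi), ∃ n : ℤ, h = h₀ + n * (2 * Real.pi) := by
  have hp : (0 : ℝ) < 2 * Real.pi := by positivity
  refine ⟨toIcoMod hp 0 h, ?_, toIcoDiv hp 0 h, ?_⟩
  · have := toIcoMod_mem_Ico hp 0 h
    rw [zero_add] at this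
    exact ⟨this.1, this.2.le⟩
  · have := toIcoMod_add_toIcoDiv_zsmul hp 0 h
    rw [zsmul_eq_mul] at this
    exact this.symm

theorem spherePoint_add_int_mul (δ : ℝ) (u : ℂ) (h : ℝ) (n : ℤ) :
    spherePoint δ u (h + n * (2 * Real.pi)) = spherePoint δ u h :=
  Function.Periodic.int_mul (f := spherePoint δ u) (spherePoint_add_two_pi δ u) n h

/-- Two representations of a point of the sphere agree up to a period, unless the point lies on
the circle where the second coordinate vanishes. -/
theorem spherePoint_injective {δ : ℝ} (hδ : 0 < δ) {u u' : ℂ} {h h' : ℝ} (hu : ‖u‖ < δ)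
    (he : spherePoint δ u h = spherePoint δ u' h') :
    u = u' ∧ ∃ n : ℤ, h = h' + n * (2 * Real.pi) := by
  simp only [spherePoint, Prod.mk.injEq] at he
  obtain ⟨rfl, he⟩ := he
  refine ⟨rfl, ?_⟩
  have hpos : 0 < √(δ ^ 2 - ‖u‖ ^ 2) := Real.sqrt_pos.mpr (by nlinarith [norm_nonneg u])
  have := mul_left_cancel₀ (by exact_mod_cast hpos.ne') he
  rw [Complex.exp_eq_exp_iff_exists_int] at this
  obtain ⟨n, hn⟩ := this
  refine ⟨n, ?_⟩
  have h2 : ((h : ℂ) - (h' + n * (2 * Real.pi))) * Complex.I = 0 := by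
    linear_combination hn
  have h3 := (mul_eq_zero.mp h2).resolve_right Complex.I_ne_zero
  exact_mod_cast sub_eq_zero.mp h3

/-- A family of bijections of the disc, parametrized by time and the argument of the second
coordinate, induces an isotopy of the three-sphere. -/
theorem ambientIsotopicIn_of_fiberwise {ι : Type*} {δ : ℝ} (hδ : 0 < δ)
    (Φ : unitInterval → ℝ → ℂ → ℂ)
    (hc : Continuous fun q : unitInterval × ℂ × ℝ => Φ q.1 q.2.2 q.2.1)
    (hper : ∀ t h u, Φ t (h + 2 * Real.pi) u = Φ t h u)
    (hbij : ∀ t h, Function.Bijective (Φ t h))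
    (hout : ∀ t h u, δ ≤ ‖u‖ → Φ t h u = u) (h0 : ∀ h u, Φ 0 h u = u)
    (p q : ι → ℝ → ℂ) (hp : ∀ j h, ‖p j h‖ ≤ δ) (hpq : ∀ j h, Φ 1 h (p j h) = q j h) :
    AmbientIsotopicIn (sphere3 δ) (fiberedSet δ p) (fiberedSet δ q) := by
  have hper' : ∀ t h u (n : ℤ), Φ t (h + n * (2 * Real.pi)) u = Φ t h u := fun t h u n =>
    Function.Periodic.int_mul (f := fun h => Φ t h u) (fun h => hper t h u) n h
  -- A point sent to norm at least δ would share its image with that outer point, which is fixed;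
  -- this contradicts injectivity.
  have hlt : ∀ t h u, ‖u‖ < δ → ‖Φ t h u‖ < δ := by
    intro t h u hu
    by_contra! hcon
    have := (hbij t h).1 (hout t h _ hcon)
    rw [this] at hcon
    exact absurd hu hcon.not_gt
  have hle : ∀ t h u, ‖u‖ ≤ δ → ‖Φ t h u‖ ≤ δ := by
    intro t h u hu
    rcases hu.lt_or_eq with hu | hu
    · exact (hlt t h u hu).le
    · rw [hout t h u hu.ge, hu]
  have : CompactSpace (sphere3 δ) := isCompact_iff_compactSpace.mp (isCompact_sphere3 hδ.le)
  -- `arg` jumps, so continuity cannot be read off this formula. It follows from `key`, which allows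
  -- any angle in place of `arg`.
  set H : unitInterval → sphere3 δ → sphere3 δ := fun t x =>
    ⟨spherePoint δ (Φ t (x : ℂ × ℂ).2.arg (x : ℂ × ℂ).1) (x : ℂ × ℂ).2.arg,
      spherePoint_mem hδ.le (hle _ _ _ (norm_fst_le_of_mem_sphere3 hδ.le x.2)) _⟩ with hH
  have key : ∀ t u h (hu : ‖u‖ ≤ δ), H t ⟨spherePoint δ u h, spherePoint_mem hδ.le hu h⟩
      = ⟨spherePoint δ (Φ t h u) h, spherePoint_mem hδ.le (hle t h u hu) h⟩ := by
    intro t u h hu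
    apply Subtype.ext
    simp only [hH]
    have hm := spherePoint_arg hδ.le (spherePoint_mem hδ.le hu h)
    set g := (spherePoint δ u h).2.arg
    change spherePoint δ (Φ t g u) g = spherePoint δ (Φ t h u) h
    change spherePoint δ u g = _ at hm
    -- Off the circle v = 0 the two angles differ by a period; on it the angle is arbitrary, but Φ
    -- is the identity there.
    rcases hu.lt_or_eq with hu | hu
    · obtain ⟨-, n, hn⟩ := spherePoint_injective hδ hu hm
      rw [hn, hper', spherePoint_add_int_mul]
    · rw [hout t _ u hu.ge, hout t _ u hu.ge, hm]
  let K : Type := Metric.closedBall (0 : ℂ) δ × Set.Icc (0 : ℝ) (2 * Real.pi)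
  let π : K → sphere3 δ := fun k => ⟨spherePoint δ k.1 k.2,
    spherePoint_mem hδ.le (mem_closedBall_zero_iff.mp k.1.2) _⟩
  have : CompactSpace (Metric.closedBall (0 : ℂ) δ) :=
    isCompact_iff_compactSpace.mp (isCompact_closedBall _ _)
  have hπc : Continuous π := by
    refine Continuous.subtype_mk ?_ _
    exact (continuous_spherePoint δ).comp
      ((continuous_subtype_val.comp continuous_fst).prodMk
        (continuous_subtype_val.comp continuous_snd))
  have hπs : Function.Surjective π := by
    intro x
    obtain ⟨g, hg, n, hn⟩ := exists_Icc_add_int_mul (x : ℂ × ℂ).2.arg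
    refine ⟨(⟨(x : ℂ × ℂ).1, mem_closedBall_zero_iff.mpr
      (norm_fst_le_of_mem_sphere3 hδ.le x.2)⟩, ⟨g, hg⟩), Subtype.ext ?_⟩
    change spherePoint δ (x : ℂ × ℂ).1 g = x
    conv_rhs => rw [← spherePoint_arg hδ.le x.2, hn, spherePoint_add_int_mul]
  have hHc : Continuous fun q : unitInterval × sphere3 δ => H q.1 q.2 := by
    -- A continuous surjection from a compact to a Hausdorff space is closed, hence a quotient map;
    -- time is included as a factor so that joint continuity descends.
    have hquot : Topology.IsQuotientMap
        (Prod.map id π : unitInterval × K → unitInterval × sphere3 δ) := by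
      have hc' : Continuous (Prod.map id π : unitInterval × K → unitInterval × sphere3 δ) :=
        continuous_id.prodMap hπc
      exact hc'.isClosedMap.isQuotientMap hc' (Function.surjective_id.prodMap hπs)
    rw [hquot.continuous_iff]
    have : ((fun q : unitInterval × sphere3 δ => H q.1 q.2) ∘ Prod.map id π)
        = fun q : unitInterval × K => ⟨spherePoint δ (Φ q.1 q.2.2 q.2.1) q.2.2,
          spherePoint_mem hδ.le (hle _ _ _ (mem_closedBall_zero_iff.mp q.2.1.2)) _⟩ := by
      funext q
      exact key q.1 q.2.1 q.2.2 (mem_closedBall_zero_iff.mp q.2.1.2)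
    rw [this]
    refine Continuous.subtype_mk ?_ _
    have c2 : Continuous fun q : unitInterval × K => ((q.2.2 : ℝ)) :=
      continuous_subtype_val.comp (continuous_snd.comp continuous_snd)
    have c1 : Continuous fun q : unitInterval × K => ((q.2.1 : ℂ)) :=
      continuous_subtype_val.comp (continuous_fst.comp continuous_snd)
    exact (continuous_spherePoint δ).comp
      ((hc.comp (continuous_fst.prodMk (c1.prodMk c2))).prodMk c2)
  have hHb : ∀ t, Function.Bijective (H t) := by
    intro t
    constructor
    · intro x y hxy
      have hx := norm_fst_le_of_mem_sphere3 hδ.le x.2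
      have hxy' := congrArg Subtype.val hxy
      simp only [hH] at hxy'
      apply Subtype.ext
      rw [← spherePoint_arg hδ.le x.2, ← spherePoint_arg hδ.le y.2]
      rcases hx.lt_or_eq with hx | hx
      · obtain ⟨h1, n, hn⟩ := spherePoint_injective hδ (hlt t _ _ hx) hxy'
        rw [hn, hper'] at h1
        rw [(hbij t _).1 h1, hn, spherePoint_add_int_mul]
      · have hy : ‖(y : ℂ × ℂ).1‖ = δ := by
          refine le_antisymm (norm_fst_le_of_mem_sphere3 hδ.le y.2) ?_
          by_contra! hcon
          have h1 := congrArg Prod.fst hxy'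
          simp only [spherePoint] at h1
          have h2 := hlt t (y : ℂ × ℂ).2.arg _ hcon
          rw [← h1, hout t _ _ hx.ge] at h2
          exact absurd hx h2.ne
        rwa [hout t _ _ hx.ge, hout t _ _ hy.ge] at hxy'
    · intro y
      obtain ⟨u, hu⟩ := (hbij t (y : ℂ × ℂ).2.arg).2 (y : ℂ × ℂ).1
      have hu' : ‖u‖ ≤ δ := by
        by_contra! hcon
        have := hout t (y : ℂ × ℂ).2.arg u hcon.le
        rw [hu] at this
        have := norm_fst_le_of_mem_sphere3 hδ.le y.2
        simp_all
        linarith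
      refine ⟨⟨spherePoint δ u _, spherePoint_mem hδ.le hu' (y : ℂ × ℂ).2.arg⟩, ?_⟩
      rw [key t u _ hu']
      apply Subtype.ext
      simp only [hu]
      exact spherePoint_arg hδ.le y.2
  refine ⟨fun t => Continuous.homeoOfEquivCompactToT2 (f := Equiv.ofBijective (H t) (hHb t))
    (hHc.comp (continuous_const.prodMk continuous_id)), hHc, ?_, ?_⟩
  · ext1 x
    apply Subtype.ext
    change spherePoint δ (Φ 0 _ _) _ = x
    rw [h0, spherePoint_arg hδ.le x.2]
  · ext y
    constructor
    · rintro ⟨x, ⟨j, h, hx⟩, rfl⟩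
      refine ⟨j, h, ?_⟩
      have : x = ⟨spherePoint δ (p j h) h, spherePoint_mem hδ.le (hp j h) h⟩ := Subtype.ext hx
      change ((H 1 x : sphere3 δ) : ℂ × ℂ) = _
      rw [this, key 1 _ _ (hp j h)]
      simp only [hpq]
    · rintro ⟨j, h, hy⟩
      refine ⟨⟨spherePoint δ (p j h) h, spherePoint_mem hδ.le (hp j h) h⟩, ⟨j, h, rfl⟩, ?_⟩
      change H 1 _ = y
      rw [key 1 _ _ (hp j h)]
      apply Subtype.ext
      simp only [hpq, hy]

/-! ### Small and large motions of strands -/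

/-- Solutions of x + g x = y are the fixed points of the contraction x ↦ y - g x. -/
theorem bijective_add_of_contracting {g : ℂ → ℂ} {K : NNReal} (hK : K < 1)
    (hg : LipschitzWith K g) : Function.Bijective fun x => x + g x := by
  have hc : ∀ y, ContractingWith K fun x => y - g x := fun y =>
    ⟨hK, LipschitzWith.of_dist_le_mul fun x x' => by
      rw [dist_sub_left]; exact hg.dist_le_mul x x'⟩
  constructor
  · intro x x' h
    refine (hc (x + g x)).fixedPoint_unique' (x := x) (y := x') ?_ ?_
    · simp [Function.IsFixedPt]
    · simp only at h
      simp [Function.IsFixedPt, h]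
  · intro y
    refine ⟨(hc y).fixedPoint, ?_⟩
    have h : y - g (hc y).fixedPoint = (hc y).fixedPoint := (hc y).fixedPoint_isFixedPt
    exact (sub_eq_iff_eq_add.mp h).symm

/-- The displacement field which moves each `p j` to `q j` and dies out at distance `η`. -/
noncomputable def bumpField {ι : Type*} [Fintype ι] (η : ℝ) (p q : ι → ℂ) (x : ℂ) : ℂ :=
  ∑ j, ((max 0 (1 - ‖x - p j‖ / η) : ℝ) : ℂ) * (q j - p j)

/-- Each bump is 1/η-Lipschitz and the displacements add up to at most η/2. The constant 1/2 makes
the identity plus the field a bijection. -/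
theorem lipschitzWith_bumpField {ι : Type*} [Fintype ι] {η : ℝ} (hη : 0 < η) {p q : ι → ℂ}
    (hpq : ∀ j, ‖q j - p j‖ * (2 * Fintype.card ι) ≤ η) :
    LipschitzWith (1 / 2) (bumpField η p q) := by
  refine LipschitzWith.of_dist_le_mul fun x y => ?_
  rw [dist_eq_norm, dist_eq_norm, bumpField, bumpField, ← Finset.sum_sub_distrib]
  have hterm : ∀ j, ‖((max 0 (1 - ‖x - p j‖ / η) : ℝ) : ℂ) * (q j - p j)
      - ((max 0 (1 - ‖y - p j‖ / η) : ℝ) : ℂ) * (q j - p j)‖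
      ≤ ‖x - y‖ / η * ‖q j - p j‖ := by
    intro j
    rw [← sub_mul, norm_mul, ← Complex.ofReal_sub, Complex.norm_real, Real.norm_eq_abs]
    gcongr
    rw [max_comm 0, max_comm 0]
    refine (abs_max_sub_max_le_abs _ _ 0).trans ?_
    rw [sub_sub_sub_cancel_left, ← sub_div, abs_div, abs_of_pos hη]
    gcongr
    have := abs_norm_sub_norm_le (y - p j) (x - p j)
    rwa [sub_sub_sub_cancel_right, norm_sub_rev y x] at this
  refine (norm_sum_le _ _).trans ((Finset.sum_le_sum fun j _ => hterm j).trans ?_)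
  rw [← Finset.mul_sum]
  have hsum : ∑ j, ‖q j - p j‖ ≤ η / 2 := by
    rcases isEmpty_or_nonempty ι with hι | hι
    · simp only [Finset.univ_eq_empty, Finset.sum_empty]
      positivity
    · have hcard : (0 : ℝ) < Fintype.card ι := by exact_mod_cast Fintype.card_pos
      have : ∀ j ∈ Finset.univ, ‖q j - p j‖ ≤ η / (2 * Fintype.card ι) := fun j _ => by
        rw [le_div_iff₀ (by positivity)]; exact hpq j
      refine (Finset.sum_le_card_nsmul _ _ _ this).trans (le_of_eq ?_)
      rw [Finset.card_univ, nsmul_eq_mul]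
      field_simp
  calc ‖x - y‖ / η * ∑ j, ‖q j - p j‖ ≤ ‖x - y‖ / η * (η / 2) := by gcongr
    _ = _ := by
      push_cast
      field_simp

theorem bumpField_self {ι : Type*} [Fintype ι] {η : ℝ} (hη : 0 < η) {p q : ι → ℂ}
    (hsep : ∀ j k, j ≠ k → η ≤ ‖p j - p k‖) (j : ι) : bumpField η p q (p j) = q j - p j := by
  rw [bumpField, Finset.sum_eq_single j]
  · simp
  · intro k _ hk
    have : (1 : ℝ) ≤ ‖p j - p k‖ / η := by
      rw [le_div_iff₀ hη, one_mul]; exact hsep j k hk.symm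
    rw [max_eq_left (by linarith)]
    simp
  · simp

theorem bumpField_eq_zero {ι : Type*} [Fintype ι] {η δ : ℝ} (hη : 0 < η) {p q : ι → ℂ}
    (hp : ∀ j, ‖p j‖ + η ≤ δ) {x : ℂ} (hx : δ ≤ ‖x‖) : bumpField η p q x = 0 := by
  refine Finset.sum_eq_zero fun j _ => ?_
  have h1 : η ≤ ‖x - p j‖ := by
    have := norm_sub_norm_le x (p j)
    linarith [hp j]
  have : (1 : ℝ) ≤ ‖x - p j‖ / η := by rwa [le_div_iff₀ hη, one_mul]
  rw [max_eq_left (by linarith)]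
  simp

/-- Strands that are close to each other sweep out ambient isotopic sets. -/
theorem ambientIsotopicIn_of_close {ι : Type*} [Fintype ι] {δ η : ℝ} (hδ : 0 < δ) (hη : 0 < η)
    {p q : ι → ℝ → ℂ} (σ : Equiv.Perm ι) (hpc : ∀ j, Continuous (p j))
    (hqc : ∀ j, Continuous (q j)) (hpσ : ∀ j h, p j (h + 2 * Real.pi) = p (σ j) h)
    (hqσ : ∀ j h, q j (h + 2 * Real.pi) = q (σ j) h)
    (hsep : ∀ h j k, j ≠ k → η ≤ ‖p j h - p k h‖) (hin : ∀ h j, ‖p j h‖ + η ≤ δ)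
    (hclose : ∀ h j, ‖q j h - p j h‖ * (2 * Fintype.card ι) ≤ η) :
    AmbientIsotopicIn (sphere3 δ) (fiberedSet δ p) (fiberedSet δ q) := by
  refine ambientIsotopicIn_of_fiberwise hδ
    (fun t h u => u + ((t : ℝ) : ℂ) * bumpField η (fun j => p j h) (fun j => q j h) u)
    ?_ ?_ ?_ ?_ ?_ p q ?_ ?_
  · unfold bumpField
    fun_prop
  · intro t h u
    -- A full turn merely permutes the summands of the field by σ.
    simp only [bumpField, hpσ, hqσ]
    congr 2
    exact Equiv.sum_comp σ fun j => ((max 0 (1 - ‖u - p j h‖ / η) : ℝ) : ℂ) * (q j h - p j h)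
  · intro t h
    refine bijective_add_of_contracting (K := 1 / 2) (by rw [← NNReal.coe_lt_coe]; norm_num) ?_
    have hl := lipschitzWith_bumpField hη (hclose h)
    refine LipschitzWith.of_dist_le_mul fun x y => ?_
    have h1 := hl.dist_le_mul x y
    rw [dist_eq_norm, ← mul_sub, norm_mul, Complex.norm_real, Real.norm_eq_abs,
      abs_of_nonneg t.2.1, ← dist_eq_norm]
    nlinarith [t.2.1, t.2.2, dist_nonneg (x := bumpField η (fun j => p j h) (fun j => q j h) x)
      (y := bumpField η (fun j => p j h) (fun j => q j h) y)]
  · intro t h u hu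
    simp [bumpField_eq_zero hη (hin h) hu]
  · simp
  · intro j h
    linarith [hin h j]
  · intro j h
    simp [bumpField_self (p := fun j => p j h) hη (hsep h)]

/-- The power σ^n serves all parameters `t` at once, so that strands for different `t` can be
compared after reduction to one period. -/
theorem exists_perm_add_int_mul {ι T α : Type*} (σ : Equiv.Perm ι) {p : T → ι → ℝ → α}
    (hpσ : ∀ t j h, p t j (h + 2 * Real.pi) = p t (σ j) h) (h₀ : ℝ) (n : ℤ) :
    ∃ τ : Equiv.Perm ι, ∀ t j, p t j (h₀ + n * (2 * Real.pi)) = p t (τ j) h₀ := by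
  refine ⟨σ ^ n, fun t => ?_⟩
  induction n with
  | zero => simp
  | succ n ih =>
    intro j
    rw [show h₀ + ((n + 1 : ℤ) : ℝ) * (2 * Real.pi) = h₀ + (n : ℤ) * (2 * Real.pi) + 2 * Real.pi by
      push_cast; ring, hpσ, ih, zpow_add_one, Equiv.Perm.mul_apply]
  | pred n ih =>
    intro j
    have h1 := ih (σ⁻¹ j)
    rw [← Equiv.Perm.mul_apply, ← zpow_sub_one] at h1
    rw [← h1, show h₀ + ((-n : ℤ) : ℝ) * (2 * Real.pi)
      = h₀ + ((-n - 1 : ℤ) : ℝ) * (2 * Real.pi) + 2 * Real.pi by push_cast; ring, hpσ]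
    simp

theorem exists_perm_Icc {ι T α : Type*} (σ : Equiv.Perm ι) {p : T → ι → ℝ → α}
    (hpσ : ∀ t j h, p t j (h + 2 * Real.pi) = p t (σ j) h) (h : ℝ) :
    ∃ h₀ ∈ Set.Icc 0 (2 * Real.pi), ∃ τ : Equiv.Perm ι, ∀ t j, p t j h = p t (τ j) h₀ := by
  obtain ⟨h₀, hh₀, n, rfl⟩ := exists_Icc_add_int_mul h
  exact ⟨h₀, hh₀, exists_perm_add_int_mul σ hpσ h₀ n⟩

/-- A positive continuous function has a positive minimum on a compact interval. The filter form
lets finitely many such bounds be combined without taking minima. -/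
theorem eventually_forall_Icc_le {f : ℝ → ℝ} (hf : Continuous f) (hpos : ∀ h, 0 < f h) :
    ∀ᶠ η in 𝓝[>] (0 : ℝ), ∀ h ∈ Set.Icc 0 (2 * Real.pi), η ≤ f h := by
  obtain ⟨h₁, -, hmin⟩ := isCompact_Icc.exists_isMinOn
    (⟨0, by constructor <;> positivity⟩ : (Set.Icc 0 (2 * Real.pi)).Nonempty) hf.continuousOn
  filter_upwards [Ioc_mem_nhdsGT (hpos h₁)] with η hη h hh
  exact hη.2.trans (hmin hh)

/-- Pairwise distinct strands have a positive distance. -/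
theorem eventually_separated {ι : Type*} [Finite ι] (σ : Equiv.Perm ι) {p : ι → ℝ → ℂ}
    (hpc : ∀ j, Continuous (p j)) (hpσ : ∀ j h, p j (h + 2 * Real.pi) = p (σ j) h)
    (hinj : ∀ h, Function.Injective fun j => p j h) :
    ∀ᶠ η in 𝓝[>] (0 : ℝ), ∀ h j k, j ≠ k → η ≤ ‖p j h - p k h‖ := by
  have h1 : ∀ᶠ η in 𝓝[>] (0 : ℝ), ∀ j k, j ≠ k → ∀ h ∈ Set.Icc 0 (2 * Real.pi),
      η ≤ ‖p j h - p k h‖ := by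
    rw [Filter.eventually_all]; intro j
    rw [Filter.eventually_all]; intro k
    rw [Filter.eventually_all]; intro hjk
    exact eventually_forall_Icc_le ((hpc j).sub (hpc k)).norm
      fun h => norm_pos_iff.mpr (sub_ne_zero.mpr ((hinj h).ne hjk))
  filter_upwards [h1] with η h1 h j k hjk
  obtain ⟨h₀, hh₀, τ, hτ⟩ := exists_perm_Icc (T := Unit) σ (p := fun _ => p) (fun _ => hpσ) h
  rw [hτ (), hτ ()]
  exact h1 _ _ (τ.injective.ne hjk) _ hh₀

/-- Moving pairwise distinct strands inside the disc is an ambient isotopy. -/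
theorem ambientIsotopicIn_of_homotopy {ι T : Type*} [Finite ι] [TopologicalSpace T]
    [PreconnectedSpace T] {δ : ℝ} (hδ : 0 < δ) (σ : Equiv.Perm ι) {p : T → ι → ℝ → ℂ}
    (hpc : ∀ j, Continuous fun x : T × ℝ => p x.1 j x.2)
    (hpσ : ∀ t j h, p t j (h + 2 * Real.pi) = p t (σ j) h)
    (hinj : ∀ t h, Function.Injective fun j => p t j h) (hin : ∀ t j h, ‖p t j h‖ < δ) (t t' : T) :
    AmbientIsotopicIn (sphere3 δ) (fiberedSet δ (p t)) (fiberedSet δ (p t')) := by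
  have := Fintype.ofFinite ι
  let r : T → T → Prop := fun t t' =>
    AmbientIsotopicIn (sphere3 δ) (fiberedSet δ (p t)) (fiberedSet δ (p t'))
  have : Std.Symm r := ⟨fun _ _ h => h.symm⟩
  -- A symmetric and transitive relation on a preconnected space is total once every point is
  -- related to all points near it. Only this local claim remains.
  refine PreconnectedSpace.induction₂ r (fun t => ?_) ⟨fun _ _ _ h k => h.trans k⟩ t t'
  have hpc' : ∀ t j, Continuous (p t j) := fun t j =>
    (hpc j).comp (continuous_const.prodMk continuous_id)
  have hcomp : IsCompact (Set.Icc 0 (2 * Real.pi)) := isCompact_Icc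
  have h1 := eventually_separated σ (hpc' t) (hpσ t) (hinj t)
  have h2 : ∀ᶠ η in 𝓝[>] (0 : ℝ), ∀ j, ∀ h ∈ Set.Icc 0 (2 * Real.pi), η ≤ δ - ‖p t j h‖ := by
    rw [Filter.eventually_all]; intro j
    exact eventually_forall_Icc_le (continuous_const.sub (hpc' t j).norm) fun h => sub_pos.mpr (hin t j h)
  obtain ⟨η, ⟨h1, h2⟩, hη⟩ := ((h1.and h2).and self_mem_nhdsWithin).exists
  have hη : 0 < η := hη
  have h3 : ∀ᶠ t' in 𝓝 t, ∀ j, ∀ h ∈ Set.Icc 0 (2 * Real.pi),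
      ‖p t' j h - p t j h‖ * (2 * Fintype.card ι) < η := by
    rw [Filter.eventually_all]; intro j
    refine hcomp.eventually_forall_of_forall_eventually fun h _ => ?_
    have hcont : Continuous fun z : T × ℝ =>
        ‖p z.1 j z.2 - p t j z.2‖ * (2 * Fintype.card ι) :=
      ((hpc j).sub ((hpc' t j).comp continuous_snd)).norm.mul continuous_const
    refine hcont.continuousAt.eventually_lt continuousAt_const ?_
    simpa using hη
  filter_upwards [h3] with t' h3
  refine ambientIsotopicIn_of_close hδ hη σ (hpc' t) (hpc' t') (hpσ t) (hpσ t') h1 ?_ ?_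
  · intro h j
    obtain ⟨h₀, hh₀, τ, hτ⟩ := exists_perm_Icc σ hpσ h
    rw [hτ]
    linarith [h2 (τ j) _ hh₀]
  · intro h j
    obtain ⟨h₀, hh₀, τ, hτ⟩ := exists_perm_Icc σ hpσ h
    rw [hτ, hτ]
    exact (h3 (τ j) _ hh₀).le

/-! ### The strands of the lemniscate braid -/

/-- The permutation of the strands when `h` runs once around the circle. -/
def strandShift (s r : ℕ) [NeZero s] : Equiv.Perm (Fin s) := Equiv.addRight (Fin.ofNat s r)

/-- A turn of h adds 2πr/s to the phase, which amounts to j ↦ j + r; reducing j + r modulo s costs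
whole turns of the phase. -/
theorem strandPhase_add_two_pi (s r : ℕ) [NeZero s] (j : Fin s) (h : ℝ) :
    ∃ n : ℕ, strandPhase s r j (h + 2 * Real.pi)
      = strandPhase s r (strandShift s r j) h + n * (2 * Real.pi) := by
  have hs : (s : ℝ) ≠ 0 := by exact_mod_cast NeZero.ne s
  have hv : ((strandShift s r j : Fin s) : ℕ) = (j + r) % s := by
    simp [strandShift, Fin.val_add]
  refine ⟨(j + r) / s, ?_⟩
  have hm : ((s * ((j + r) / s) + (j + r) % s : ℕ) : ℝ) = ((j + r : ℕ) : ℝ) :=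
    congrArg _ (Nat.div_add_mod _ _)
  push_cast at hm
  rw [strandPhase, strandPhase, hv]
  field_simp
  linear_combination (-2 * Real.pi) * hm

theorem strandZ_add_two_pi (a b : ℝ) (s r l : ℕ) [NeZero s] (j : Fin s) (h : ℝ) :
    strandZ a b s r l j (h + 2 * Real.pi) = strandZ a b s r l (strandShift s r j) h := by
  obtain ⟨n, hn⟩ := strandPhase_add_two_pi s r j h
  simp only [strandZ, strandX, strandY, hn, Real.cos_add_nat_mul_two_pi]
  congr 2
  rw [mul_add, ← mul_assoc, ← Nat.cast_mul, Real.sin_add_nat_mul_two_pi]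

theorem continuous_strandPhase (s r j : ℕ) : Continuous (strandPhase s r j) := by
  unfold strandPhase
  fun_prop

theorem continuous_strandZ {T : Type*} [TopologicalSpace T] {a b h : T → ℝ} (s r l j : ℕ)
    (ha : Continuous a) (hb : Continuous b) (hh : Continuous h) :
    Continuous fun t => strandZ (a t) (b t) s r l j (h t) := by
  have hp := (continuous_strandPhase s r j).comp hh
  have e : (fun t => strandZ (a t) (b t) s r l j (h t)) = fun t =>
      ((a t * Real.cos (strandPhase s r j (h t)) : ℝ) : ℂ)
        + ((b t / l * Real.sin (l * strandPhase s r j (h t)) : ℝ) : ℂ) * Complex.I := by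
    funext t
    rw [← Complex.mk_eq_add_mul_I]
    rfl
  rw [e]
  simp only [Function.comp_def] at hp
  fun_prop

theorem norm_strandZ_le {a b : ℝ} (ha : 0 ≤ a) (hb : 0 ≤ b) (s r : ℕ) {l : ℕ} (hl : 0 < l)
    (j : ℕ) (h : ℝ) : ‖strandZ a b s r l j h‖ ≤ a + b := by
  refine (Complex.norm_le_abs_re_add_abs_im _).trans (add_le_add ?_ ?_)
  · simp only [strandZ, strandX, abs_mul, abs_of_nonneg ha]
    exact mul_le_of_le_one_right ha (Real.abs_cos_le_one _)
  · have : (1 : ℝ) ≤ l := by exact_mod_cast hl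
    simp only [strandZ, strandY, abs_mul, abs_div, abs_of_nonneg hb, Nat.abs_cast]
    exact (mul_le_of_le_one_right (by positivity) (Real.abs_sin_le_one _)).trans
      (div_le_self hb this)

theorem strandZ_mul (c a b : ℝ) (s r l j : ℕ) (h : ℝ) :
    strandZ (c * a) (c * b) s r l j h = c * strandZ a b s r l j h := by
  apply Complex.ext <;> simp [strandZ, strandX, strandY] <;> ring

/-- The strands are pairwise disjoint. -/
theorem strandZ_injective {a b : ℝ} (ha : a ≠ 0) (hb : b ≠ 0) {s r l : ℕ} (hs : 0 < s)
    (hl : 0 < l) (hsl : Nat.Coprime s l) (h : ℝ) :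
    Function.Injective fun j : Fin s => strandZ a b s r l j h := by
  intro j k hjk
  have hs0 : (s : ℝ) ≠ 0 := by exact_mod_cast hs.ne'
  have hl0 : (l : ℝ) ≠ 0 := by exact_mod_cast hl.ne'
  have hpi := Real.pi_ne_zero
  have hX := congrArg Complex.re hjk
  have hY := congrArg Complex.im hjk
  simp only [strandZ, strandX, strandY] at hX hY
  have hX := mul_left_cancel₀ ha hX
  have hY := mul_left_cancel₀ (div_ne_zero hb hl0) hY
  have hdiv : (s : ℤ) ∣ l * (j - k) → j = k := by
    intro hd
    have hd := (Nat.isCoprime_iff_coprime.mpr hsl).dvd_of_dvd_mul_left hd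
    have hj := j.2
    have hk := k.2
    have := Int.eq_zero_of_abs_lt_dvd hd (by rw [abs_lt]; constructor <;> omega)
    apply Fin.ext
    omega
  have hdiff : s * (strandPhase s r j h - strandPhase s r k h) = 2 * Real.pi * (j - k) := by
    simp only [strandPhase]
    field_simp
    ring
  rw [Real.cos_eq_cos_iff] at hX
  obtain ⟨n, hn | hn⟩ := hX
  · refine hdiv (Dvd.dvd.mul_left ⟨-n, ?_⟩ _)
    have : (2 * Real.pi) * ((j : ℝ) - k) = (2 * Real.pi) * (s * -n) := by
      rw [← hdiff, hn]; ring
    have := mul_left_cancel₀ (by positivity) this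
    exact_mod_cast this
  -- Opposite phases: equal heights then force sin(lφ_j) = 0, so lφ_j is a multiple of π and l(j -
  -- k) is again divisible by s. Coprimality finishes as in the other case.
  · have e : (l : ℝ) * strandPhase s r k h
        = -(l * strandPhase s r j h) + ((l * n : ℤ) : ℝ) * (2 * Real.pi) := by
      rw [hn]; push_cast; ring
    rw [e, Real.sin_add_int_mul_two_pi, Real.sin_neg] at hY
    have h0 : Real.sin (l * strandPhase s r j h) = 0 := by linarith
    obtain ⟨m, hm⟩ := Real.sin_eq_zero_iff.mp h0
    refine hdiv ⟨m - l * n + m - l * n + (l * n - m), ?_⟩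
    have : Real.pi * ((l : ℝ) * (j - k)) = Real.pi * (s * (m - l * n)) := by
      have h1 : (l : ℝ) * (2 * Real.pi * (j - k)) = 2 * Real.pi * (s * (m - l * n)) := by
        rw [← hdiff, hn]
        linear_combination (-2 * s : ℝ) * hm
      linarith
    have := mul_left_cancel₀ hpi this
    have : (l : ℤ) * ((j : ℤ) - k) = s * (m - l * n) := by exact_mod_cast this
    rw [this]; ring

/-! ### Stereographic projection of the closed braid -/

/-- The first coordinate of the inverse stereographic projection, on a half plane bounded by the
axis. -/
noncomputable def halfPlaneToDisc (w : ℂ) : ℂ :=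
  (((Complex.normSq w - 1 : ℝ) : ℂ) + ((2 * w.im : ℝ) : ℂ) * Complex.I)
    / ((Complex.normSq w + 1 : ℝ) : ℂ)

/-- A deformation of `ζ ↦ halfPlaneToDisc (1 + ζ)` (for `e = 1`) to the identity (for `e = 0`). -/
noncomputable def rescaledHalfPlaneToDisc (e : ℝ) (ζ : ℂ) : ℂ :=
  (2 * ζ + ((e * Complex.normSq ζ : ℝ) : ℂ))
    / ((Complex.normSq (1 + e * ζ) + 1 : ℝ) : ℂ)

theorem halfPlaneToDisc_re (w : ℂ) :
    (halfPlaneToDisc w).re = (Complex.normSq w - 1) / (Complex.normSq w + 1) := by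
  rw [halfPlaneToDisc, Complex.div_ofReal_re]
  simp

theorem halfPlaneToDisc_im (w : ℂ) :
    (halfPlaneToDisc w).im = 2 * w.im / (Complex.normSq w + 1) := by
  rw [halfPlaneToDisc, Complex.div_ofReal_im]
  simp

/-- With `w.re` the distance to the axis and `w.im` the height, the right side is |v|² for the
projected point, so this is |u|² + |v|² = 1. -/
theorem one_sub_norm_halfPlaneToDisc_sq (w : ℂ) :
    1 - ‖halfPlaneToDisc w‖ ^ 2 = (2 * w.re / (Complex.normSq w + 1)) ^ 2 := by
  have : Complex.normSq w + 1 ≠ 0 := by linarith [Complex.normSq_nonneg w]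
  rw [Complex.sq_norm, Complex.normSq_apply, halfPlaneToDisc_re, halfPlaneToDisc_im]
  field_simp
  rw [Complex.normSq_apply]
  ring

theorem norm_halfPlaneToDisc_lt_one {w : ℂ} (hw : 0 < w.re) : ‖halfPlaneToDisc w‖ < 1 := by
  have h1 := one_sub_norm_halfPlaneToDisc_sq w
  have h2 : 0 < (2 * w.re / (Complex.normSq w + 1)) ^ 2 := by
    have := Complex.normSq_nonneg w
    positivity
  nlinarith [norm_nonneg (halfPlaneToDisc w)]

/-- The real part of the image determines |w|², then the imaginary part determines Im w, and the
sign of Re w settles the rest. -/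
theorem halfPlaneToDisc_injOn : Set.InjOn halfPlaneToDisc {w | 0 < w.re} := by
  intro w hw w' hw' he
  have hre := congrArg Complex.re he
  have him := congrArg Complex.im he
  rw [halfPlaneToDisc_re, halfPlaneToDisc_re] at hre
  rw [halfPlaneToDisc_im, halfPlaneToDisc_im] at him
  have h1 := Complex.normSq_nonneg w
  have h2 := Complex.normSq_nonneg w'
  have hq : Complex.normSq w = Complex.normSq w' := by
    rw [div_eq_div_iff (by linarith) (by linarith)] at hre
    linarith
  rw [hq, div_left_inj' (by linarith)] at him
  have him : w.im = w'.im := by linarith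
  refine Complex.ext ?_ him
  rw [Complex.normSq_apply, Complex.normSq_apply, him] at hq
  have : w.re ^ 2 = w'.re ^ 2 := by linarith
  exact (pow_left_inj₀ (le_of_lt hw) (le_of_lt hw') two_ne_zero).mp this

theorem continuous_halfPlaneToDisc : Continuous halfPlaneToDisc := by
  unfold halfPlaneToDisc
  refine Continuous.div ?_ ?_ fun w => ?_
  · have := Complex.continuous_normSq
    fun_prop
  · have := Complex.continuous_normSq
    fun_prop
  · exact_mod_cast (by linarith [Complex.normSq_nonneg w] : Complex.normSq w + 1 ≠ 0)

theorem continuous_rescaledHalfPlaneToDisc :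
    Continuous fun q : ℝ × ℂ => rescaledHalfPlaneToDisc q.1 q.2 := by
  unfold rescaledHalfPlaneToDisc
  refine Continuous.div ?_ ?_ fun q => ?_
  · have := Complex.continuous_normSq
    fun_prop
  · have := Complex.continuous_normSq
    fun_prop
  · exact_mod_cast
      (by linarith [Complex.normSq_nonneg (1 + q.1 * q.2)] : Complex.normSq (1 + q.1 * q.2) + 1 ≠ 0)

theorem rescaledHalfPlaneToDisc_zero (ζ : ℂ) : rescaledHalfPlaneToDisc 0 ζ = ζ := by
  simp [rescaledHalfPlaneToDisc]
  norm_num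

/-- The numerator |1 + eζ|² - 1 + 2i Im(eζ) equals e(2ζ + e|ζ|²). Dividing out e is what makes the
deformation regular at e = 0. -/
theorem mul_rescaledHalfPlaneToDisc (e : ℝ) (ζ : ℂ) :
    e * rescaledHalfPlaneToDisc e ζ = halfPlaneToDisc (1 + e * ζ) := by
  rw [rescaledHalfPlaneToDisc, halfPlaneToDisc, ← mul_div_assoc]
  congr 1
  apply Complex.ext <;> simp [Complex.normSq_apply] <;> ring

theorem rescaledHalfPlaneToDisc_one (ζ : ℂ) :
    rescaledHalfPlaneToDisc 1 ζ = halfPlaneToDisc (1 + ζ) := by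
  simpa using mul_rescaledHalfPlaneToDisc 1 ζ

/-- The radius 1/4 is a convenience: the numerator has norm below 2/4 + 1/16 < 1, and the
denominator exceeds 1. -/
theorem norm_rescaledHalfPlaneToDisc_lt_one {e : ℝ} (he : e ∈ Set.Icc 0 1) {ζ : ℂ}
    (hζ : ‖ζ‖ < 1 / 4) : ‖rescaledHalfPlaneToDisc e ζ‖ < 1 := by
  have h1 : 3 / 4 < ‖1 + (e : ℂ) * ζ‖ := by
    have h := norm_sub_norm_le (1 : ℂ) (-(e * ζ))
    rw [norm_one, norm_neg, norm_mul, Complex.norm_real, Real.norm_eq_abs, abs_of_nonneg he.1,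
      sub_neg_eq_add] at h
    nlinarith [he.1, he.2, norm_nonneg ζ]
  have h2 : 9 / 16 < Complex.normSq (1 + e * ζ) := by
    rw [← Complex.sq_norm]; nlinarith
  have h3 : ‖2 * ζ + ((e * Complex.normSq ζ : ℝ) : ℂ)‖ < 1 := by
    refine (norm_add_le _ _).trans_lt ?_
    rw [norm_mul, Complex.norm_two, Complex.norm_real, Real.norm_eq_abs,
      abs_of_nonneg (mul_nonneg he.1 (Complex.normSq_nonneg _)), ← Complex.sq_norm]
    nlinarith [he.1, he.2, norm_nonneg ζ, sq_nonneg ‖ζ‖]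
  rw [rescaledHalfPlaneToDisc, norm_div, Complex.norm_real, Real.norm_eq_abs,
    abs_of_pos (by linarith), div_lt_one (by linarith)]
  linarith

theorem rescaledHalfPlaneToDisc_injOn {e : ℝ} (he : e ∈ Set.Icc 0 1) :
    Set.InjOn (rescaledHalfPlaneToDisc e) {ζ | ‖ζ‖ < 1 / 4} := by
  intro ζ hζ ζ' hζ' h
  rcases eq_or_ne e 0 with rfl | he0
  · simpa [rescaledHalfPlaneToDisc_zero] using h
  have hre : ∀ {z : ℂ}, ‖z‖ < 1 / 4 → 0 < (1 + e * z).re := by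
    intro z hz
    have h1 := (abs_le.mp (Complex.abs_re_le_norm z)).1
    rw [Complex.add_re, Complex.one_re, Complex.re_ofReal_mul]
    nlinarith [he.1, he.2]
  have h2 := congrArg ((e : ℂ) * ·) h
  simp only [mul_rescaledHalfPlaneToDisc] at h2
  have h3 := halfPlaneToDisc_injOn (hre hζ) (hre hζ') h2
  exact mul_left_cancel₀ (by exact_mod_cast he0) (add_left_cancel h3)

/-- Rotation about the axis by h preserves u and multiplies v by e^{ih}, so only the picture in one
half plane matters. Positivity of R + Re Z identifies the square root with |v|. -/
theorem invStereo_closedBraid_point {δ : ℝ} (hδ : 0 < δ) {R h : ℝ} {Z : ℂ} (hZ : 0 < R + Z.re) :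
    let p : ℝ × ℝ × ℝ := (Real.cos h * (R + Z.re), Real.sin h * (R + Z.re), Z.im)
    ((δ : ℂ) * (invStereo p).1, (δ : ℂ) * (invStereo p).2)
      = spherePoint δ (δ * halfPlaneToDisc (R + Z)) h := by
  intro p
  have hq : p.1 ^ 2 + p.2.1 ^ 2 + p.2.2 ^ 2 = Complex.normSq (R + Z) := by
    simp only [p, Complex.normSq_apply, Complex.add_re, Complex.add_im, Complex.ofReal_re,
      Complex.ofReal_im]
    linear_combination ((R + Z.re) ^ 2) * Real.sin_sq_add_cos_sq h
  have hN := Complex.normSq_nonneg (R + Z)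
  have hsq : √(δ ^ 2 - ‖(δ : ℂ) * halfPlaneToDisc (R + Z)‖ ^ 2)
      = δ * (2 * (R + Z.re) / (Complex.normSq (R + Z) + 1)) := by
    rw [norm_mul, Complex.norm_real, Real.norm_eq_abs, abs_of_pos hδ, mul_pow,
      ← mul_one_sub, one_sub_norm_halfPlaneToDisc_sq, ← mul_pow, Real.sqrt_sq]
    · simp
    · simp only [Complex.add_re, Complex.ofReal_re]
      positivity
  rw [spherePoint, hsq]
  refine Prod.ext ?_ ?_
  · simp only [invStereo, hq]
    congr 1
    apply Complex.ext
    · rw [halfPlaneToDisc_re]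
    · rw [halfPlaneToDisc_im]
      simp [p]
  · simp only [invStereo, hq]
    rw [Complex.exp_mul_I, ← Complex.ofReal_cos, ← Complex.ofReal_sin]
    apply Complex.ext <;>
      simp only [p, Complex.re_ofReal_mul, Complex.im_ofReal_mul, Complex.add_re, Complex.add_im,
        Complex.ofReal_re, Complex.ofReal_im,
        Complex.I_re, Complex.I_im] <;> ring

/-- The closed braid uses only heights in [0, 2π]; other heights add no points, because full turns
permute the strands. -/
theorem lemniscateLink_eq_fiberedSet {δ : ℝ} (hδ : 0 < δ) {a b R : ℝ} (ha : 0 < a) (haR : a < R)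
    (s r l : ℕ) [NeZero s] :
    lemniscateLink δ a b R s r l = fiberedSet δ fun (j : Fin s) h =>
      δ * halfPlaneToDisc (R + strandZ a b s r l j h) := by
  have hpos : ∀ j h, 0 < R + (strandZ a b s r l j h).re := by
    intro j h
    have : -a ≤ a * Real.cos (strandPhase s r j h) := by
      nlinarith [Real.neg_one_le_cos (strandPhase s r j h)]
    simp only [strandZ, strandX]
    linarith
  have hpoint : ∀ j h, (fun p => ((δ : ℂ) * (invStereo p).1, (δ : ℂ) * (invStereo p).2))
      (Real.cos h * (R + strandX a s r j h), Real.sin h * (R + strandX a s r j h),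
        strandY b s r l j h) = spherePoint δ (δ * halfPlaneToDisc (R + strandZ a b s r l j h)) h := by
    intro j h
    have := invStereo_closedBraid_point (h := h) hδ (hpos j h)
    simp only [strandZ] at this ⊢
    exact this
  ext x
  constructor
  · rintro ⟨p, ⟨j, hj, h, -, rfl⟩, rfl⟩
    exact ⟨⟨j, hj⟩, h, hpoint j h⟩
  · rintro ⟨j, h, rfl⟩
    obtain ⟨h₀, hh₀, n, rfl⟩ := exists_Icc_add_int_mul h
    obtain ⟨τ, hτ⟩ := exists_perm_add_int_mul (T := Unit) (strandShift s r)
      (p := fun _ j h => strandZ a b s r l (j : Fin s) h)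
      (fun _ j h => strandZ_add_two_pi a b s r l j h) h₀ n
    have hτ := hτ ()
    simp only [hτ, spherePoint_add_int_mul]
    exact ⟨_, ⟨τ j, (τ j).2, h₀, hh₀, rfl⟩, hpoint (τ j) h₀⟩

/-- Since δ²Z_j is δ times the strand with stretching factors δa and δb, which by `hab` has norm
below 1/4, `rescaledHalfPlaneToDisc` deforms these strands to the projected thin closed braid with R
= 1. A second homotopy varies the stretching factors and R. -/
theorem ambientIsotopicIn_lemniscateLink {δ a b : ℝ} (hδ : 0 < δ) (ha : 0 < a) (hb : 0 < b)
    (hab : δ * (a + b) < 1 / 4) {s r l : ℕ} [NeZero s] (hl : 0 < l) (hsl : Nat.Coprime s l)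
    {a' b' R : ℝ} (ha' : 0 < a') (hb' : 0 < b') (haR : a' < R) :
    AmbientIsotopicIn (sphere3 δ)
      (fiberedSet δ fun (j : Fin s) h => (δ : ℂ) ^ 2 * strandZ a b s r l j h)
      (lemniscateLink δ a' b' R s r l) := by
  have hs : 0 < s := NeZero.pos s
  have hnorm : ∀ z : ℂ, ‖z‖ < 1 → ‖(δ : ℂ) * z‖ < δ := by
    intro z hz
    rw [norm_mul, Complex.norm_real, Real.norm_eq_abs, abs_of_pos hδ]
    nlinarith
  have hδ0 : (δ : ℂ) ≠ 0 := by exact_mod_cast hδ.ne'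
  have hsmall : ∀ j h, ‖strandZ (δ * a) (δ * b) s r l j h‖ < 1 / 4 := fun j h =>
    (norm_strandZ_le (by positivity) (by positivity) s r hl j h).trans_lt (by linarith)
  have hZinj : ∀ {a b : ℝ}, 0 < a → 0 < b → ∀ h,
      Function.Injective fun j : Fin s => strandZ a b s r l j h := fun ha hb h =>
    strandZ_injective ha.ne' hb.ne' hs hl hsl h
  have leg1 := ambientIsotopicIn_of_homotopy (T := unitInterval) hδ (strandShift s r)
    (p := fun e j h => δ * rescaledHalfPlaneToDisc e (strandZ (δ * a) (δ * b) s r l (j : Fin s) h))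
    (fun j => continuous_const.mul (continuous_rescaledHalfPlaneToDisc.comp
      ((continuous_subtype_val.comp continuous_fst).prodMk
        (continuous_strandZ s r l j continuous_const continuous_const continuous_snd))))
    (fun t j h => by rw [strandZ_add_two_pi])
    (fun t h j k hjk => hZinj (by positivity) (by positivity) h
      (rescaledHalfPlaneToDisc_injOn t.2 (hsmall j h) (hsmall k h) (mul_left_cancel₀ hδ0 hjk)))
    (fun t j h => hnorm _ (norm_rescaledHalfPlaneToDisc_lt_one t.2 (hsmall j h))) 0 1
  have e0 : (fun (j : Fin s) h => (δ : ℂ) * rescaledHalfPlaneToDisc (0 : unitInterval)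
      (strandZ (δ * a) (δ * b) s r l j h)) =
        fun (j : Fin s) h => (δ : ℂ) ^ 2 * strandZ a b s r l j h := by
    funext j h
    rw [Set.Icc.coe_zero, rescaledHalfPlaneToDisc_zero, strandZ_mul]
    ring
  rw [e0] at leg1
  refine leg1.trans ?_
  -- The admissible triples (a, b, R) form a convex set, so (δa, δb, 1) is connected to (a', b', R)
  -- within it.
  let T : Set (ℝ × ℝ × ℝ) := {q | 0 < q.1 ∧ 0 < q.2.1 ∧ q.1 < q.2.2}
  have hT : Convex ℝ T := by
    rintro ⟨x, y, z⟩ ⟨h1, h2, h3⟩ ⟨x', y', z'⟩ ⟨h1', h2', h3'⟩ c d hc hd hcd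
    simp only at h1 h2 h3 h1' h2' h3'
    have key : ∀ {m n : ℝ}, 0 < m → 0 < n → 0 < c * m + d * n := fun hm hn => by
      rcases hc.eq_or_lt with rfl | hc
      · have : d = 1 := by linarith
        subst this; linarith
      · have := mul_pos hc hm
        have := mul_nonneg hd hn.le
        linarith
    refine ⟨key h1 h1', key h2 h2', ?_⟩
    have := key (sub_pos.mpr h3) (sub_pos.mpr h3')
    simp only [Prod.smul_mk, Prod.mk_add_mk, smul_eq_mul]
    linarith
  have : PreconnectedSpace T := isPreconnected_iff_preconnectedSpace.mp hT.isPreconnected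
  have hpos : ∀ (t : T) j h, 0 < ((t.1.2.2 : ℂ) + strandZ t.1.1 t.1.2.1 s r l j h).re := by
    rintro ⟨⟨x, y, z⟩, h1, h2, h3⟩ j h
    simp only at h1 h2 h3
    have : -x ≤ x * Real.cos (strandPhase s r j h) := by
      nlinarith [Real.neg_one_le_cos (strandPhase s r j h)]
    simp only [strandZ, strandX, Complex.add_re, Complex.ofReal_re]
    linarith
  have hsub : Continuous fun x : T × ℝ => (x.1 : ℝ × ℝ × ℝ) :=
    continuous_subtype_val.comp continuous_fst
  have leg2 := ambientIsotopicIn_of_homotopy (T := T) hδ (strandShift s r)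
    (p := fun t j h => δ * halfPlaneToDisc (t.1.2.2 + strandZ t.1.1 t.1.2.1 s r l (j : Fin s) h))
    (fun j => continuous_const.mul (continuous_halfPlaneToDisc.comp
      ((Complex.continuous_ofReal.comp hsub.snd.snd).add
        (continuous_strandZ s r l j hsub.fst hsub.snd.fst continuous_snd))))
    (fun t j h => by rw [strandZ_add_two_pi])
    (fun t h j k hjk => hZinj t.2.1 t.2.2.1 h (add_left_cancel
      (halfPlaneToDisc_injOn (hpos t j h) (hpos t k h) (mul_left_cancel₀ hδ0 hjk))))
    (fun t j h => hnorm _ (norm_halfPlaneToDisc_lt_one (hpos t j h)))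
    ⟨(δ * a, δ * b, 1), by positivity, by positivity, by
      change δ * a < 1
      nlinarith [mul_pos hδ hb]⟩ ⟨(a', b', R), ha', hb', haR⟩
  rw [lemniscateLink_eq_fiberedSet hδ ha' haR]
  have e1 : (fun (j : Fin s) h => (δ : ℂ) * rescaledHalfPlaneToDisc (1 : unitInterval)
      (strandZ (δ * a) (δ * b) s r l j h)) = fun j h =>
        δ * halfPlaneToDisc ((1 : ℝ) + strandZ (δ * a) (δ * b) s r l (j : Fin s) h) := by
    funext j h
    rw [Set.Icc.coe_one, rescaledHalfPlaneToDisc_one, Complex.ofReal_one]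
  rw [e1]
  exact leg2

/-! ### Coefficients of the braid polynomial -/

section Coefficients

open LaurentPolynomial

/-- Substituting cX for X pulls a factor c out of each of the s factors; that c is a unit allows c^k
to be cancelled. -/
theorem prod_X_sub_C_mul_coeff {R : Type*} [CommRing R] {c : R} (hc : IsUnit c) (s : ℕ) (z : ℕ → R)
    {k : ℕ} (hk : k ≤ s) :
    (∏ j ∈ Finset.range s, (Polynomial.X - Polynomial.C (c * z j))).coeff k
      = c ^ (s - k) * (∏ j ∈ Finset.range s, (Polynomial.X - Polynomial.C (z j))).coeff k := by
  have h : (∏ j ∈ Finset.range s, (Polynomial.X - Polynomial.C (c * z j))).comp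
      (Polynomial.C c * Polynomial.X)
      = Polynomial.C (c ^ s) * ∏ j ∈ Finset.range s, (Polynomial.X - Polynomial.C (z j)) := by
    rw [Polynomial.prod_comp]
    simp only [Polynomial.sub_comp, Polynomial.X_comp, Polynomial.C_comp]
    simp only [Polynomial.C_mul, ← mul_sub, Finset.prod_mul_distrib, Finset.prod_const,
      Finset.card_range, Polynomial.C_pow]
  have h2 := congrArg (Polynomial.coeff · k) h
  simp only [Polynomial.comp_C_mul_X_coeff, Polynomial.coeff_C_mul] at h2
  apply (hc.pow k).mul_right_cancel
  rw [h2, mul_right_comm, ← pow_add, Nat.sub_add_cancel hk]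

theorem laurentRoot_mul (c a b : ℝ) (r l : ℕ) (w : ℂ) :
    laurentRoot (c * a) (c * b) r l w = C (c : ℂ) * laurentRoot a b r l w := by
  have h1 : ((c * a : ℝ) : ℂ) / 2 = c * (a / 2) := by push_cast; ring
  have h2 : ((c * b : ℝ) : ℂ) / (2 * l) = c * (b / (2 * l)) := by push_cast; ring
  simp only [laurentRoot, h1, h2, map_mul]
  ring

theorem laurentBraidPoly_mul_coeff {c : ℝ} (hc : c ≠ 0) (a b : ℝ) {s k : ℕ} (r l : ℕ)
    (hk : k ≤ s) :
    ((laurentBraidPoly (c * a) (c * b) s r l).coeff k).coeff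
      = (c : ℂ) ^ (s - k) • ((laurentBraidPoly a b s r l).coeff k).coeff := by
  have hu : IsUnit (C (c : ℂ) : LaurentPolynomial ℂ) :=
    (IsUnit.mk0 (c : ℂ) (by exact_mod_cast hc)).map C
  simp only [laurentBraidPoly, laurentRoot_mul]
  rw [prod_X_sub_C_mul_coeff hu s _ hk, ← map_pow, ← smul_eq_C_mul]
  rfl

theorem laurentBraidPoly_coeff_self (a b : ℝ) (s r l : ℕ) :
    (laurentBraidPoly a b s r l).coeff s = 1 := by
  have hm : (laurentBraidPoly a b s r l).Monic :=
    Polynomial.monic_prod_of_monic _ _ fun j _ => Polynomial.monic_X_sub_C _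
  have hd : (laurentBraidPoly a b s r l).natDegree = s := by
    rw [laurentBraidPoly, Polynomial.natDegree_prod_of_monic _ _
      fun j _ => Polynomial.monic_X_sub_C _]
    simp
  simpa [hd] using hm.coeff_natDegree

/-- For even `r` only even powers of `T ^ s = exp(i h)` occur in the braid polynomial. -/
theorem even_of_coeff_ne_zero (a b : ℝ) {s r : ℕ} (l : ℕ) (hs : 0 < s) (hr : Even r) (k : ℕ)
    {m : ℤ} (hn : ((laurentBraidPoly a b s r l).coeff k).coeff (s * m) ≠ 0) : Even m := by
  obtain ⟨r', rfl⟩ := hr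
  have hs0 : (s : ℂ) ≠ 0 := by exact_mod_cast hs.ne'
  -- T ↦ tT corresponds to h ↦ h + π. As t² is the root of unity and r = 2r', it shifts the strand
  -- index by r' and preserves the product; t^s = -1 then yields (-1)^m = 1.
  set t : ℂ := Complex.exp (Real.pi * Complex.I / s) with ht
  have ht2 : t ^ 2 = unityRoot s := by
    rw [ht, unityRoot, ← Complex.exp_nat_mul]
    congr 1
    push_cast
    ring
  have hts : t ^ s = -1 := by
    rw [ht, ← Complex.exp_nat_mul, mul_div_cancel₀ _ hs0, Complex.exp_pi_mul_I]
  set w : ℂˣ := Units.mk0 t (Complex.exp_ne_zero _) with hwdef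
  have hroot : ∀ j, twist w (laurentRoot a b (r' + r') l (unityRoot s ^ j))
      = laurentRoot a b (r' + r') l (unityRoot s ^ (j + r')) := by
    intro j
    have e0 : t ^ (r' + r') = unityRoot s ^ r' := by rw [← ht2, ← pow_mul]; ring
    have e1 : t ^ (l * (r' + r' : ℕ) : ℤ) = (unityRoot s ^ r') ^ l := by
      rw [← e0, ← pow_mul, mul_comm (r' + r') l]
      exact_mod_cast zpow_natCast t (l * (r' + r'))
    simp only [laurentRoot, map_add, map_sub, twist_C_mul_T, hwdef, Units.val_mk0]
    simp only [zpow_neg, e1, zpow_natCast, e0, pow_add, mul_pow, mul_inv, mul_assoc]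
  have hinv : (laurentBraidPoly a b s (r' + r') l).map (twist w)
      = laurentBraidPoly a b s (r' + r') l := by
    rw [laurentBraidPoly, Polynomial.map_prod]
    simp only [Polynomial.map_sub, Polynomial.map_X, Polynomial.map_C, hroot]
    exact prod_range_shift (fun j => Polynomial.X - Polynomial.C
      (laurentRoot a b (r' + r') l (unityRoot s ^ j))) s
      (fun j => by simp only [pow_add, unityRoot_pow s hs, mul_one]) r'
  have h1 : twist w ((laurentBraidPoly a b s (r' + r') l).coeff k)
      = (laurentBraidPoly a b s (r' + r') l).coeff k := by
    rw [← Polynomial.coeff_map, hinv]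
  have h2 := twist_coeff w ((laurentBraidPoly a b s (r' + r') l).coeff k) (s * m)
  rw [h1] at h2
  have h3 : t ^ ((s : ℤ) * m) = 1 := by
    have := mul_left_cancel₀ hn ((mul_one _).trans h2)
    simpa [hwdef] using this.symm
  rw [zpow_mul, zpow_natCast, hts] at h3
  by_contra hodd
  rw [Int.not_even_iff_odd] at hodd
  rw [hodd.neg_one_zpow] at h3
  norm_num at h3

/-- The monomial of `braidPoly` that stems from `u ^ k T ^ n`. -/
noncomputable def braidMonomial (s k : ℕ) (n : ℤ) : Fin 3 →₀ ℕ :=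
  Finsupp.single 0 k + Finsupp.single 1 (n / s).toNat + Finsupp.single 2 (-(n / s)).toNat

theorem braidMonomial_apply (s k : ℕ) (n : ℤ) :
    braidMonomial s k n 0 = k ∧ braidMonomial s k n 1 = (n / s).toNat ∧
      braidMonomial s k n 2 = (-(n / s)).toNat := by
  simp [braidMonomial]

/-- In this form it is not necessary to know that different exponents n give different monomials. -/
theorem coeff_braidPoly (a b : ℝ) (s r l : ℕ) (d : Fin 3 →₀ ℕ) :
    (braidPoly a b s r l).coeff d = ∑ k ∈ Finset.range (s + 1),
      ((laurentBraidPoly a b s r l).coeff k).coeff.sum fun n c =>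
        if braidMonomial s k n = d then c else 0 := by
  rw [braidPoly, MvPolynomial.coeff_sum]
  refine Finset.sum_congr rfl fun k _ => ?_
  rw [Finsupp.sum, Finsupp.sum, MvPolynomial.coeff_sum]
  refine Finset.sum_congr rfl fun n _ => ?_
  rw [← MvPolynomial.coeff_monomial, braidMonomial]
  congr 1
  rw [MvPolynomial.X_pow_eq_monomial, MvPolynomial.X_pow_eq_monomial,
    MvPolynomial.X_pow_eq_monomial, MvPolynomial.C_apply, MvPolynomial.monomial_mul,
    MvPolynomial.monomial_mul, MvPolynomial.monomial_mul]
  simp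

/-- Up to sign the coefficient of u^k is an elementary symmetric function of degree s - k in the
roots, and the roots are linear in the stretching. -/
theorem coeff_braidPoly_mul {c : ℝ} (hc : c ≠ 0) (a b : ℝ) (s r l : ℕ) (d : Fin 3 →₀ ℕ) :
    (braidPoly (c * a) (c * b) s r l).coeff d
      = (c : ℂ) ^ (s - d 0) * (braidPoly a b s r l).coeff d := by
  rw [coeff_braidPoly, coeff_braidPoly, Finset.mul_sum]
  refine Finset.sum_congr rfl fun k hk => ?_
  rw [laurentBraidPoly_mul_coeff hc a b r l (Finset.mem_range_succ_iff.mp hk),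
    Finsupp.sum_smul_index (by simp), Finsupp.sum, Finsupp.sum, Finset.mul_sum]
  refine Finset.sum_congr rfl fun n _ => ?_
  split_ifs with h
  · rw [← h, (braidMonomial_apply s k n).1]
  · simp

theorem support_braidPoly_mul {c : ℝ} (hc : c ≠ 0) (a b : ℝ) (s r l : ℕ) :
    (braidPoly (c * a) (c * b) s r l).support = (braidPoly a b s r l).support := by
  ext d
  have : (c : ℂ) ≠ 0 := by exact_mod_cast hc
  simp [MvPolynomial.mem_support_iff, coeff_braidPoly_mul hc, this]

/-- Thus the exponent deg f_ρ in F does not vary with ρ > 0. -/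
theorem totalDegree_braidPoly_mul {c : ℝ} (hc : c ≠ 0) (a b : ℝ) (s r l : ℕ) :
    (braidPoly (c * a) (c * b) s r l).totalDegree = (braidPoly a b s r l).totalDegree := by
  rw [MvPolynomial.totalDegree, MvPolynomial.totalDegree, support_braidPoly_mul hc]

theorem exists_of_mem_support_braidPoly {a b : ℝ} {s r l : ℕ} {d : Fin 3 →₀ ℕ}
    (hd : d ∈ (braidPoly a b s r l).support) : ∃ k ≤ s, ∃ n,
      ((laurentBraidPoly a b s r l).coeff k).coeff n ≠ 0 ∧ braidMonomial s k n = d := by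
  rw [MvPolynomial.mem_support_iff, coeff_braidPoly] at hd
  obtain ⟨k, hk, h⟩ := Finset.exists_ne_zero_of_sum_ne_zero hd
  obtain ⟨n, -, h⟩ := Finset.exists_ne_zero_of_sum_ne_zero h
  refine ⟨k, Finset.mem_range_succ_iff.mp hk, n, ?_⟩
  dsimp only at h
  split_ifs at h with he
  · exact ⟨h, he⟩
  · exact absurd rfl h

theorem le_of_mem_support_braidPoly {a b : ℝ} {s r l : ℕ} {d : Fin 3 →₀ ℕ}
    (hd : d ∈ (braidPoly a b s r l).support) : d 0 ≤ s := by
  obtain ⟨k, hk, n, -, rfl⟩ := exists_of_mem_support_braidPoly hd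
  rwa [(braidMonomial_apply s k n).1]

theorem even_of_mem_support_braidPoly {a b : ℝ} {s r l : ℕ} (hs : 0 < s) (hr : Even r)
    {d : Fin 3 →₀ ℕ} (hd : d ∈ (braidPoly a b s r l).support) : Even (d 1 + d 2) := by
  obtain ⟨k, hk, n, hn, rfl⟩ := exists_of_mem_support_braidPoly hd
  obtain ⟨m, rfl⟩ := dvd_of_coeff_ne_zero a b s r l hs k n hn
  have hm := even_of_coeff_ne_zero a b l hs hr k hn
  have hs1 : (s : ℤ) ≠ 0 := by exact_mod_cast hs.ne'
  rw [(braidMonomial_apply _ _ _).2.1, (braidMonomial_apply _ _ _).2.2,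
    Int.mul_ediv_cancel_left _ hs1]
  obtain ⟨q, rfl⟩ := hm
  exact ⟨q.toNat + (-q).toNat, by omega⟩

/-- The braid polynomial is monic in u, so its top coefficient involves no power of T. This feeds
the Cauchy bound on the roots. -/
theorem eq_single_of_mem_support_braidPoly {a b : ℝ} {s r l : ℕ} {d : Fin 3 →₀ ℕ}
    (hd : d ∈ (braidPoly a b s r l).support) (h : d 0 = s) : d = Finsupp.single 0 s := by
  obtain ⟨k, hk, n, hn, rfl⟩ := exists_of_mem_support_braidPoly hd
  rw [(braidMonomial_apply s k n).1] at h
  subst h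
  rw [laurentBraidPoly_coeff_self, ← T_zero, T_apply] at hn
  have : n = 0 := by
    by_contra hne
    simp [Ne.symm hne] at hn
  simp [braidMonomial, this]

theorem coeff_braidPoly_single (a b : ℝ) (s r l : ℕ) :
    (braidPoly a b s r l).coeff (Finsupp.single 0 s) = 1 := by
  rw [coeff_braidPoly, Finset.sum_eq_single s]
  · rw [laurentBraidPoly_coeff_self, ← T_zero, T, AddMonoidAlgebra.coeff_single,
      Finsupp.sum_single_index] <;> simp [braidMonomial]
  · intro k _ hk
    refine Finset.sum_eq_zero fun n _ => if_neg fun h => hk ?_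
    rw [← (braidMonomial_apply s k n).1, h, Finsupp.single_eq_same]
  · simp

end Coefficients

/-! ### Homogeneity of f and the formula for F -/

theorem braidFun_eq_sum (a b : ℝ) (s r l : ℕ) (u v : ℂ) :
    braidFun a b s r l u v = ∑ d ∈ (braidPoly a b s r l).support,
      (braidPoly a b s r l).coeff d * (u ^ d 0 * v ^ d 1 * (starRingEnd ℂ) v ^ d 2) := by
  rw [braidFun, MvPolynomial.eval_eq']
  simp [Fin.prod_univ_three]

theorem braidFun_mul {c : ℝ} (hc : c ≠ 0) (a b : ℝ) (s r l : ℕ) (u v : ℂ) :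
    braidFun (c * a) (c * b) s r l u v = (c : ℂ) ^ s * braidFun a b s r l (u / c) v := by
  have hc' : (c : ℂ) ≠ 0 := by exact_mod_cast hc
  rw [braidFun_eq_sum, braidFun_eq_sum, support_braidPoly_mul hc, Finset.mul_sum]
  refine Finset.sum_congr rfl fun d hd => ?_
  have h : (c : ℂ) ^ s = c ^ (s - d 0) * c ^ d 0 := by
    rw [← pow_add, Nat.sub_add_cancel (le_of_mem_support_braidPoly hd)]
  rw [coeff_braidPoly_mul hc, h, div_pow]
  field_simp

theorem rho_pos {u v : ℂ} (h : (u, v) ≠ (0, 0)) : 0 < rho u v := by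
  refine Real.sqrt_pos.mpr ?_
  by_contra! hle
  refine h (Prod.ext ?_ ?_)
  · exact norm_eq_zero.mp (pow_eq_zero_iff two_ne_zero |>.mp (by nlinarith [sq_nonneg ‖u‖, sq_nonneg ‖v‖]))
  · exact norm_eq_zero.mp (pow_eq_zero_iff two_ne_zero |>.mp (by nlinarith [sq_nonneg ‖u‖, sq_nonneg ‖v‖]))

theorem rescaledFun_eq (a b : ℝ) (s r l : ℕ) {u v : ℂ} (h : (u, v) ≠ (0, 0)) :
    rescaledFun a b s r l u v =
      (rho u v : ℂ) ^ (s + (braidPoly (rho u v * a) (rho u v * b) s r l).totalDegree)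
        * braidFun a b s r l (u / (rho u v : ℂ) ^ 2) (v / rho u v) := by
  rw [rescaledFun, braidFun_mul (rho_pos h).ne', div_div, pow_two, pow_add]
  ring

/-! ### Real polynomial maps with complex values -/

/-- The value of a real polynomial map `ℝ⁴ → ℝ²` as a complex number. -/
noncomputable def polyValue (P : Fin 2 → MvPolynomial (Fin 4) ℝ) (x : Fin 4 → ℝ) : ℂ :=
  ⟨MvPolynomial.eval x (P 0), MvPolynomial.eval x (P 1)⟩

/-- The complex valued functions on `ℝ⁴` with polynomial real and imaginary parts. -/
noncomputable def realPolynomialFunctions : Subalgebra ℝ ((Fin 4 → ℝ) → ℂ) where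
  carrier := Set.range polyValue
  mul_mem' := by
    rintro _ _ ⟨p, rfl⟩ ⟨q, rfl⟩
    refine ⟨![p 0 * q 0 - p 1 * q 1, p 0 * q 1 + p 1 * q 0], ?_⟩
    funext x
    apply Complex.ext <;> simp [polyValue]
  add_mem' := by
    rintro _ _ ⟨p, rfl⟩ ⟨q, rfl⟩
    refine ⟨p + q, ?_⟩
    funext x
    apply Complex.ext <;> simp [polyValue]
  algebraMap_mem' c := by
    refine ⟨![MvPolynomial.C c, 0], ?_⟩
    funext x
    apply Complex.ext <;> simp [polyValue]

theorem const_mem_realPolynomialFunctions (c : ℂ) : (fun _ => c) ∈ realPolynomialFunctions := by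
  refine ⟨![MvPolynomial.C c.re, MvPolynomial.C c.im], ?_⟩
  funext x
  apply Complex.ext <;> simp [polyValue]

/-- The exponents `e d` belong to u, v, v̄ and ρ². Closure of a subalgebra replaces any explicit
real and imaginary parts. -/
theorem exists_polyValue_eq_sum {ι : Type*} (S : Finset ι) (c : ι → ℂ) (e : ι → Fin 4 → ℕ) :
    ∃ q : Fin 2 → MvPolynomial (Fin 4) ℝ, ∀ u v : ℂ, polyValue q (realCoords u v)
      = ∑ d ∈ S, c d * (u ^ e d 0 * v ^ e d 1 * (starRingEnd ℂ) v ^ e d 2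
        * ((‖u‖ ^ 2 + ‖v‖ ^ 2 : ℝ) : ℂ) ^ e d 3) := by
  have hu : (fun x : Fin 4 → ℝ => (⟨x 0, x 1⟩ : ℂ)) ∈ realPolynomialFunctions :=
    ⟨![MvPolynomial.X 0, MvPolynomial.X 1], by funext x; simp [polyValue]⟩
  have hv : (fun x : Fin 4 → ℝ => (⟨x 2, x 3⟩ : ℂ)) ∈ realPolynomialFunctions :=
    ⟨![MvPolynomial.X 2, MvPolynomial.X 3], by funext x; simp [polyValue]⟩
  have hw : (fun x : Fin 4 → ℝ => (⟨x 2, -x 3⟩ : ℂ)) ∈ realPolynomialFunctions :=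
    ⟨![MvPolynomial.X 2, -MvPolynomial.X 3], by funext x; simp [polyValue]⟩
  have hn : (fun x : Fin 4 → ℝ => (⟨x 0 ^ 2 + x 1 ^ 2 + x 2 ^ 2 + x 3 ^ 2, 0⟩ : ℂ))
      ∈ realPolynomialFunctions :=
    ⟨![MvPolynomial.X 0 ^ 2 + MvPolynomial.X 1 ^ 2 + MvPolynomial.X 2 ^ 2 + MvPolynomial.X 3 ^ 2,
      0], by funext x; simp [polyValue]⟩
  have hsum := realPolynomialFunctions.sum_mem (t := S) fun d _ =>
    mul_mem (const_mem_realPolynomialFunctions (c d)) (mul_mem (mul_mem (mul_mem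
      (pow_mem hu (e d 0)) (pow_mem hv (e d 1))) (pow_mem hw (e d 2))) (pow_mem hn (e d 3)))
  obtain ⟨q, hq⟩ := hsum
  refine ⟨q, fun u v => ?_⟩
  rw [hq]
  have hnorm : u.re ^ 2 + u.im ^ 2 + v.re ^ 2 + v.im ^ 2 = ‖u‖ ^ 2 + ‖v‖ ^ 2 := by
    rw [Complex.sq_norm, Complex.sq_norm, Complex.normSq_apply, Complex.normSq_apply]
    ring
  simp only [Finset.sum_apply, Pi.mul_apply, Pi.pow_apply]
  simp only [realCoords, Matrix.cons_val_zero, Matrix.cons_val_one, Matrix.cons_val, hnorm]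
  rfl

theorem exists_polyValue_eq (a b : ℝ) {s r : ℕ} (l : ℕ) (hs : 0 < s) (hr : Even r) :
    ∃ P : Fin 2 → MvPolynomial (Fin 4) ℝ, IsSingularPoint P 0 ∧ IsNodalPoint P 0 ∧
      ∀ u v : ℂ, (u, v) ≠ (0, 0) → polyValue P (realCoords u v)
        = (rho u v : ℂ) ^ (2 * (s + (braidPoly a b s r l).totalDegree + 1))
          * braidFun a b s r l (u / (rho u v : ℂ) ^ 2) (v / rho u v) := by
  set D := (braidPoly a b s r l).totalDegree
  -- The last exponent is what remains of (ρ²)^{s+D} after the denominators ρ^{2 d 0} and ρ^{d 1 + d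
  -- 2}. The subtractions do not truncate, as d 0 ≤ s and d 1 + d 2 ≤ D, and the halving is exact by
  -- evenness.
  obtain ⟨q, hq⟩ := exists_polyValue_eq_sum (braidPoly a b s r l).support
    (fun d => (braidPoly a b s r l).coeff d)
    fun d => ![d 0, d 1, d 2, s + D - d 0 - (d 1 + d 2) / 2]
  -- The extra factor ρ² makes both the value and the Jacobian vanish at the origin whatever q is.
  set N : MvPolynomial (Fin 4) ℝ := ∑ i, MvPolynomial.X i ^ 2 with hN
  have hNe : ∀ u v : ℂ, MvPolynomial.eval (realCoords u v) N = rho u v ^ 2 := by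
    intro u v
    rw [rho, Real.sq_sqrt (by positivity), Complex.sq_norm, Complex.sq_norm, Complex.normSq_apply,
      Complex.normSq_apply, hN]
    simp [Fin.sum_univ_four, realCoords]
    ring
  have hN0 : MvPolynomial.eval 0 N = 0 := by simp [hN]
  have hN1 : ∀ j, MvPolynomial.eval 0 (MvPolynomial.pderiv j N) = 0 := by
    intro j
    simp [hN]
  refine ⟨fun i => N * q i, ?_, fun i => by rw [map_mul, hN0, zero_mul], ?_⟩
  · have : polyJacobian (fun i => N * q i) 0 = 0 := by
      ext i j
      rw [polyJacobian, Matrix.of_apply, MvPolynomial.pderiv_mul, map_add, map_mul, map_mul, hN0,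
        hN1, zero_mul, zero_mul, add_zero, Matrix.zero_apply]
    rw [IsSingularPoint, this, Matrix.rank_zero]
    norm_num
  · intro u v h
    have hρ := rho_pos h
    have hρ' : (rho u v : ℂ) ≠ 0 := by exact_mod_cast hρ.ne'
    have e1 : polyValue (fun i => N * q i) (realCoords u v)
        = (rho u v : ℂ) ^ 2 * polyValue q (realCoords u v) := by
      rw [← Complex.ofReal_pow]
      apply Complex.ext <;> simp [polyValue, hNe, -Complex.ofReal_pow]
    have e2 : ((‖u‖ ^ 2 + ‖v‖ ^ 2 : ℝ) : ℂ) = (rho u v : ℂ) ^ 2 := by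
      rw [rho, ← Complex.ofReal_pow, Real.sq_sqrt (by positivity)]
    rw [e1, hq, braidFun_eq_sum, e2, Finset.mul_sum, Finset.mul_sum]
    refine Finset.sum_congr rfl fun d hd => ?_
    obtain ⟨m, hm⟩ := even_of_mem_support_braidPoly hs hr hd
    have h0 := le_of_mem_support_braidPoly hd
    have h1 : d 0 + d 1 + d 2 ≤ D := by
      have := MvPolynomial.le_totalDegree hd
      rwa [Finsupp.sum_fintype _ _ (fun _ => rfl), Fin.sum_univ_three] at this
    have h2 : (d 1 + d 2) / 2 = m := by omega
    have h3 : 2 * (s + D + 1) = 2 + 2 * (s + D - d 0 - m) + 2 * d 0 + d 1 + d 2 := by omega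
    simp only [Matrix.cons_val_zero, Matrix.cons_val_one, Matrix.cons_val, h2]
    rw [h3, div_pow, div_pow, map_div₀, Complex.conj_ofReal, div_pow]
    simp only [pow_add, pow_mul]
    field_simp

/-! ### Roots of a family of functions near given simple roots -/

/-- Compactness gives uniformity in h over one period, and the symmetry under σ extends it to all h.
In the applications w is the displacement from a root. -/
theorem exists_uniform_nhd {ι : Type*} [Finite ι] (σ : Equiv.Perm ι) {F : ι → (ℝ × ℂ) × ℝ → ℝ}
    (hF : ∀ j, Continuous (F j)) (hFσ : ∀ x j h, F j (x, h + 2 * Real.pi) = F (σ j) (x, h)) {c : ℝ}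
    (h0 : ∀ j h, F j (0, h) < c) :
    ∃ ε > 0, ∀ (t : ℝ) (w : ℂ), |t| < ε → ‖w‖ < ε → ∀ j h, F j ((t, w), h) < c := by
  have h1 : ∀ᶠ x in 𝓝 (0 : ℝ × ℂ), ∀ j, ∀ h ∈ Set.Icc 0 (2 * Real.pi), F j (x, h) < c := by
    rw [Filter.eventually_all]; intro j
    exact isCompact_Icc.eventually_forall_of_forall_eventually fun h _ =>
      (hF j).continuousAt.eventually_lt continuousAt_const (h0 j h)
  obtain ⟨ε, hε, h2⟩ := Metric.eventually_nhds_iff.mp h1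
  refine ⟨ε, hε, fun t w ht hw j h => ?_⟩
  obtain ⟨h₀, hh₀, τ, hτ⟩ := exists_perm_Icc (T := ℝ × ℂ) σ (p := fun x j h => F j (x, h)) hFσ h
  rw [hτ (t, w) j]
  refine h2 ?_ _ _ hh₀
  rw [dist_zero_right, Prod.norm_def]
  exact max_lt ht hw

/-- A contraction estimate on a ball around an approximate root yields a unique root. -/
theorem exists_unique_root {g : ℂ → ℂ} {c Z : ℂ} {η : ℝ} (hη : 0 ≤ η) (hc : c ≠ 0)
    (hg : ∀ z ∈ Metric.closedBall Z η, ∀ z' ∈ Metric.closedBall Z η,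
      ‖(z - z') - c * (g z - g z')‖ ≤ 1 / 2 * ‖z - z'‖)
    (hZ : ‖c * g Z‖ ≤ η / 2) :
    ∃ z ∈ Metric.closedBall Z η, g z = 0 ∧ ∀ z' ∈ Metric.closedBall Z η, g z' = 0 → z' = z := by
  -- The simplified Newton map: its fixed points are the zeros of g because c ≠ 0.
  set T : ℂ → ℂ := fun z => z - c * g z with hT
  have hlip : ∀ z ∈ Metric.closedBall Z η, ∀ z' ∈ Metric.closedBall Z η,
      ‖T z - T z'‖ ≤ 1 / 2 * ‖z - z'‖ := by
    intro z hz z' hz'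
    refine le_trans (le_of_eq ?_) (hg z hz z' hz')
    congr 1
    simp only [hT]
    ring
  have hZm : Z ∈ Metric.closedBall Z η := Metric.mem_closedBall_self hη
  have hmaps : Set.MapsTo T (Metric.closedBall Z η) (Metric.closedBall Z η) := by
    intro z hz
    have h1 := hlip z hz Z hZm
    rw [mem_closedBall_iff_norm] at hz ⊢
    have h2 : T z - Z = (T z - T Z) - c * g Z := by simp only [hT]; ring
    rw [h2]
    refine (norm_sub_le _ _).trans ?_
    linarith
  have hcon : ContractingWith (1 / 2) (hmaps.restrict T _ _) := by
    refine ⟨by rw [← NNReal.coe_lt_coe]; norm_num, LipschitzWith.of_dist_le_mul fun x y => ?_⟩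
    rw [Subtype.dist_eq, Subtype.dist_eq, dist_eq_norm, dist_eq_norm]
    simpa using hlip x x.2 y y.2
  obtain ⟨z, hz, hfix, -⟩ := hcon.exists_fixedPoint' Metric.isClosed_closedBall.isComplete hmaps hZm
    (edist_ne_top _ _)
  refine ⟨z, hz, ?_, fun z' hz' hz0 => ?_⟩
  · have : z - c * g z = z := hfix
    simpa [hc] using this
  · have h1 := hlip z' hz' z hz
    have e1 : T z' = z' := by simp [hT, hz0]
    have e2 : T z = z := hfix
    rw [e1, e2] at h1
    exact sub_eq_zero.mp (norm_eq_zero.mp (by linarith [norm_nonneg (z' - z)]))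

/-- A `C¹` family of functions of a complex variable, `2π`-periodic in `h`, with continuously
varying simple roots `Z j h` for the parameter value `0`. -/
structure SimpleRootFamily (ι : Type*) (σ : Equiv.Perm ι) (G : ℝ → ℂ → ℝ → ℂ)
    (Z : ι → ℝ → ℂ) : Prop where
  contDiff : ContDiff ℝ 1 fun q : ℝ × ℂ × ℝ => G q.1 q.2.1 q.2.2
  periodic : ∀ t z h, G t z (h + 2 * Real.pi) = G t z h
  continuous_root : ∀ j, Continuous (Z j)
  root_perm : ∀ j h, Z j (h + 2 * Real.pi) = Z (σ j) h
  root : ∀ j h, G 0 (Z j h) h = 0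
  simple : ∀ j h, ∃ d : ℂ, d ≠ 0 ∧ HasDerivAt (fun z => G 0 z h) d (Z j h)

namespace SimpleRootFamily

variable {ι : Type*} {σ : Equiv.Perm ι} {G : ℝ → ℂ → ℝ → ℂ} {Z : ι → ℝ → ℂ}

theorem hasFDerivAt (H : SimpleRootFamily ι σ G Z) (t : ℝ) (z : ℂ) (h : ℝ) :
    HasFDerivAt (fun z => G t z h) (fderiv ℝ (fun z => G t z h) z) z := by
  have h1 : ContDiff ℝ 1 fun z : ℂ => G t z h :=
    H.contDiff.comp (contDiff_const.prodMk (contDiff_id.prodMk contDiff_const))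
  exact (h1.differentiable one_ne_zero z).hasFDerivAt

/-- The partial derivative is the total one restricted to the z-directions. It is taken over ℝ, as
complex differentiability is assumed only for `G 0` at its roots. -/
theorem continuous_fderiv (H : SimpleRootFamily ι σ G Z) :
    Continuous fun q : ℝ × ℂ × ℝ => fderiv ℝ (fun z => G q.1 z q.2.2) q.2.1 := by
  have h1 := H.contDiff.continuous_fderiv one_ne_zero
  have e : (fun q : ℝ × ℂ × ℝ => fderiv ℝ (fun z => G q.1 z q.2.2) q.2.1)
      = fun q => (fderiv ℝ (fun q : ℝ × ℂ × ℝ => G q.1 q.2.1 q.2.2) q).comp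
        ((0 : ℂ →L[ℝ] ℝ).prod ((ContinuousLinearMap.id ℝ ℂ).prod (0 : ℂ →L[ℝ] ℝ))) := by
    funext ⟨t, z, h⟩
    refine HasFDerivAt.fderiv ?_
    have h2 : HasFDerivAt (fun z : ℂ => ((t, z, h) : ℝ × ℂ × ℝ))
        ((0 : ℂ →L[ℝ] ℝ).prod ((ContinuousLinearMap.id ℝ ℂ).prod (0 : ℂ →L[ℝ] ℝ))) z :=
      (hasFDerivAt_const t z).prodMk ((hasFDerivAt_id z).prodMk (hasFDerivAt_const h z))
    exact ((H.contDiff.differentiable one_ne_zero (t, z, h)).hasFDerivAt).comp z h2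
  rw [e]
  exact h1.clm_comp continuous_const

/-- The inverse of the derivative at a root. -/
noncomputable def slope (G : ℝ → ℂ → ℝ → ℂ) (z : ℂ) (h : ℝ) : ℂ :=
  (fderiv ℝ (fun z => G 0 z h) z 1)⁻¹

/-- A complex derivative acts as multiplication by a number d, so its value at 1 recovers d, and d⁻¹
inverts it. -/
theorem slope_spec (H : SimpleRootFamily ι σ G Z) (j : ι) (h : ℝ) :
    slope G (Z j h) h ≠ 0 ∧ slope G (Z j h) h • fderiv ℝ (fun z => G 0 z h) (Z j h)
      = ContinuousLinearMap.id ℝ ℂ := by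
  obtain ⟨d, hd, hder⟩ := H.simple j h
  have e := (hder.hasFDerivAt.restrictScalars ℝ).fderiv
  have e1 : slope G (Z j h) h = d⁻¹ := by simp [slope, e]
  refine ⟨by simp [e1, hd], ?_⟩
  rw [e1, e]
  refine ContinuousLinearMap.ext fun x => ?_
  simp only [smul_apply, ContinuousLinearMap.coe_restrictScalars',
    ContinuousLinearMap.toSpanSingleton_apply, smul_eq_mul, ContinuousLinearMap.id_apply]
  field_simp

theorem continuous_slope (H : SimpleRootFamily ι σ G Z) (j : ι) :
    Continuous fun h => slope G (Z j h) h := by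
  refine Continuous.inv₀ ?_ fun h => fun h0 => (H.slope_spec j h).1 (by rw [slope, h0, inv_zero])
  exact (H.continuous_fderiv.comp
    (continuous_const.prodMk ((H.continuous_root j).prodMk continuous_id))).clm_apply
      continuous_const

theorem slope_perm (H : SimpleRootFamily ι σ G Z) (j : ι) (h : ℝ) :
    slope G (Z j (h + 2 * Real.pi)) (h + 2 * Real.pi) = slope G (Z (σ j) h) h := by
  simp only [slope, H.root_perm, H.periodic]

/-- The norm vanishes for t = 0 at the roots themselves and depends continuously on everything, so
it stays small uniformly in h. -/
theorem exists_fderiv_near (H : SimpleRootFamily ι σ G Z) [Finite ι] :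
    ∃ η > 0, ∀ t, |t| < η → ∀ j h, ∀ z ∈ Metric.closedBall (Z j h) η,
      ‖ContinuousLinearMap.id ℝ ℂ - slope G (Z j h) h • fderiv ℝ (fun z => G t z h) z‖
        ≤ 1 / 2 := by
  obtain ⟨ε, hε, h1⟩ := exists_uniform_nhd σ (c := 1 / 2) (F := fun j x =>
    ‖ContinuousLinearMap.id ℝ ℂ
      - slope G (Z j x.2) x.2 • fderiv ℝ (fun z => G x.1.1 z x.2) (Z j x.2 + x.1.2)‖)
    (fun j => (continuous_const.sub (((H.continuous_slope j).comp continuous_snd).smul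
      (H.continuous_fderiv.comp (continuous_fst.fst.prodMk ((((H.continuous_root j).comp
        continuous_snd).add continuous_fst.snd).prodMk continuous_snd))))).norm)
    (fun x j h => by
      simp only [H.slope_perm]
      simp only [H.periodic, H.root_perm])
    (fun j h => by simp [(H.slope_spec j h).2])
  refine ⟨ε / 2, by positivity, fun t ht j h z hz => ?_⟩
  have := h1 t (z - Z j h) (by linarith)
    (by rw [mem_closedBall_iff_norm] at hz; linarith) j h
  simpa using this.le

/-- Mean value inequality for the simplified Newton map on the convex ball. -/
theorem contraction (H : SimpleRootFamily ι σ G Z) {η t : ℝ} {j : ι} {h : ℝ}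
    (hη : ∀ z ∈ Metric.closedBall (Z j h) η,
      ‖ContinuousLinearMap.id ℝ ℂ - slope G (Z j h) h • fderiv ℝ (fun z => G t z h) z‖ ≤ 1 / 2) :
    ∀ z ∈ Metric.closedBall (Z j h) η, ∀ z' ∈ Metric.closedBall (Z j h) η,
      ‖(z - z') - slope G (Z j h) h * (G t z h - G t z' h)‖ ≤ 1 / 2 * ‖z - z'‖ := by
  intro z hz z' hz'
  have hder : ∀ x ∈ Metric.closedBall (Z j h) η, HasFDerivWithinAt
      (fun z => z - slope G (Z j h) h * G t z h)
      (ContinuousLinearMap.id ℝ ℂ - slope G (Z j h) h • fderiv ℝ (fun z => G t z h) x)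
      (Metric.closedBall (Z j h) η) x := fun x _ =>
    ((hasFDerivAt_id x).sub ((H.hasFDerivAt t x h).const_smul
      (slope G (Z j h) h))).hasFDerivWithinAt
  have := (convex_closedBall (Z j h) η).norm_image_sub_le_of_norm_hasFDerivWithin_le hder hη hz' hz
  refine le_trans (le_of_eq ?_) this
  congr 1
  ring

/-- The roots persist as continuous functions of `h` for small parameter values. -/
theorem exists_roots (H : SimpleRootFamily ι σ G Z) [Finite ι] {η η' : ℝ} (hη' : 0 < η')
    (hηη : η' < η)
    (hη : ∀ t, |t| < η → ∀ j h, ∀ z ∈ Metric.closedBall (Z j h) η,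
      ‖ContinuousLinearMap.id ℝ ℂ - slope G (Z j h) h • fderiv ℝ (fun z => G t z h) z‖
        ≤ 1 / 2) :
    ∃ ε > 0, ∀ t, |t| < ε → ∃ p : ι → ℝ → ℂ, (∀ j, Continuous (p j)) ∧
      (∀ j h, p j (h + 2 * Real.pi) = p (σ j) h) ∧
      (∀ j h, p j h ∈ Metric.closedBall (Z j h) η' ∧ G t (p j h) h = 0) ∧
      ∀ j h, ∀ z ∈ Metric.closedBall (Z j h) η', G t z h = 0 → z = p j h := by
  have hGc := H.contDiff.continuous
  obtain ⟨ε, hε, h1⟩ := exists_uniform_nhd σ (c := η' / 2) (F := fun j x =>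
    ‖slope G (Z j x.2) x.2 * G x.1.1 (Z j x.2) x.2‖)
    (fun j => (((H.continuous_slope j).comp continuous_snd).mul (hGc.comp
      (continuous_fst.fst.prodMk (((H.continuous_root j).comp continuous_snd).prodMk
        continuous_snd)))).norm)
    (fun x j h => by
      simp only [H.slope_perm]
      simp only [H.periodic, H.root_perm])
    (fun j h => by simp [H.root j h, hη'])
  refine ⟨min ε η, lt_min hε (hη'.trans hηη), fun t ht => ?_⟩
  have hcon : ∀ j h, _ := fun j h => H.contraction (hη t (ht.trans_le (min_le_right _ _)) j h)
  have hsub : ∀ j h, Metric.closedBall (Z j h) η' ⊆ Metric.closedBall (Z j h) η :=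
    fun j h => Metric.closedBall_subset_closedBall hηη.le
  have hroot : ∀ j h, ∃ z ∈ Metric.closedBall (Z j h) η', G t z h = 0 ∧
      ∀ z' ∈ Metric.closedBall (Z j h) η', G t z' h = 0 → z' = z := fun j h =>
    exists_unique_root (g := fun z => G t z h) hη'.le (H.slope_spec j h).1
      (fun z hz z' hz' => hcon j h z (hsub j h hz) z' (hsub j h hz'))
      (h1 t 0 (ht.trans_le (min_le_left _ _)) (by simpa using hε) j h).le
  choose p hp hp0 hpu using hroot
  refine ⟨p, fun j => ?_, fun j h => ?_, fun j h => ⟨hp j h, hp0 j h⟩, hpu⟩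
  · rw [continuous_iff_continuousAt]
    intro h
    have hcont : Continuous fun h' => 2 * ‖slope G (Z j h') h' * G t (p j h) h'‖ :=
      continuous_const.mul ((H.continuous_slope j).mul (hGc.comp
        (continuous_const.prodMk (continuous_const.prodMk continuous_id)))).norm
    have hlim : Filter.Tendsto (fun h' => 2 * ‖slope G (Z j h') h' * G t (p j h) h'‖) (𝓝 h)
        (𝓝 0) := by
      simpa [hp0 j h] using hcont.tendsto h
    -- Here η' < η is used: the frozen root `p j h` stays in the larger ball about `Z j h'`. The
    -- contraction estimate there bounds its distance to `p j h'` by twice the residual, which tends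
    -- to 0.
    have hnear : ∀ᶠ h' in 𝓝 h, ‖p j h - Z j h'‖ < η := by
      have : Continuous fun h' => ‖p j h - Z j h'‖ :=
        (continuous_const.sub (H.continuous_root j)).norm
      refine this.continuousAt.eventually_lt continuousAt_const ?_
      exact (mem_closedBall_iff_norm.mp (hp j h)).trans_lt hηη
    rw [ContinuousAt, tendsto_iff_norm_sub_tendsto_zero]
    refine squeeze_zero' (Filter.Eventually.of_forall fun _ => norm_nonneg _) ?_ hlim
    filter_upwards [hnear] with h' hh'
    have h2 := hcon j h' (p j h') (hsub j h' (hp j h')) (p j h)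
      (mem_closedBall_iff_norm.mpr hh'.le)
    rw [hp0 j h', zero_sub, mul_neg, sub_neg_eq_add] at h2
    have h3 := norm_sub_le ((p j h' - p j h) + slope G (Z j h') h' * G t (p j h) h')
      (slope G (Z j h') h' * G t (p j h) h')
    rw [add_sub_cancel_right] at h3
    linarith
  -- Both sides are roots in the same ball, so uniqueness identifies them.
  · refine hpu (σ j) h _ ?_ ?_
    · rw [← H.root_perm]
      exact hp _ _
    · rw [← H.periodic]
      exact hp0 _ _

/-- At a root near `Z j h` the derivative remains surjective. -/
theorem surjective_fderiv {t : ℝ} {z c : ℂ} {h : ℝ}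
    (hle : ‖ContinuousLinearMap.id ℝ ℂ - c • fderiv ℝ (fun z => G t z h) z‖ ≤ 1 / 2) :
    Function.Surjective (fderiv ℝ (fun z => G t z h) z) := by
  set L := fderiv ℝ (fun z => G t z h) z
  have hinj : Function.Injective L := by
    rw [injective_iff_map_eq_zero]
    intro w hw
    have h1 := (ContinuousLinearMap.id ℝ ℂ - c • L).le_of_opNorm_le hle w
    simp only [sub_apply, smul_apply, hw, smul_zero,
      sub_zero, ContinuousLinearMap.id_apply] at h1
    exact norm_eq_zero.mp (by linarith [norm_nonneg w])
  exact LinearMap.injective_iff_surjective (f := (L : ℂ →ₗ[ℝ] ℂ)).mp hinj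

end SimpleRootFamily

/-! ### The braid polynomial on small spheres -/

/-- The braid polynomial at `v = √(1 - t|z|²) exp(i h)`; for even `r` this is smooth in `t`. -/
noncomputable def braidDeform (a b : ℝ) (s r l : ℕ) (t : ℝ) (z : ℂ) (h : ℝ) : ℂ :=
  ∑ d ∈ (braidPoly a b s r l).support, (braidPoly a b s r l).coeff d *
    (z ^ d 0 * (((1 - t * ‖z‖ ^ 2) ^ ((d 1 + d 2) / 2) : ℝ) *
      (Complex.exp (Complex.I * h) ^ d 1 * Complex.exp (-(Complex.I * h)) ^ d 2)))

theorem conj_exp_I_mul (h : ℝ) :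
    (starRingEnd ℂ) (Complex.exp (Complex.I * h)) = Complex.exp (-(Complex.I * h)) := by
  rw [← Complex.exp_conj, map_mul, Complex.conj_I, Complex.conj_ofReal, neg_mul]

/-- The square root enters with the even exponent d 1 + d 2 and so disappears, which leaves a
polynomial in t. -/
theorem braidDeform_eq_braidFun (a b : ℝ) {s r : ℕ} (l : ℕ) (hs : 0 < s) (hr : Even r) {t : ℝ}
    {z : ℂ} (ht : 0 ≤ 1 - t * ‖z‖ ^ 2) (h : ℝ) : braidDeform a b s r l t z h
      = braidFun a b s r l z ((√(1 - t * ‖z‖ ^ 2) : ℝ) * Complex.exp (h * Complex.I)) := by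
  rw [braidDeform, braidFun_eq_sum]
  refine Finset.sum_congr rfl fun d hd => ?_
  obtain ⟨m, hm⟩ := even_of_mem_support_braidPoly hs hr hd
  have h2 : (d 1 + d 2) / 2 = m := by omega
  have h3 : (((1 - t * ‖z‖ ^ 2) ^ m : ℝ) : ℂ)
      = ((√(1 - t * ‖z‖ ^ 2) : ℝ) : ℂ) ^ d 1 * ((√(1 - t * ‖z‖ ^ 2) : ℝ) : ℂ) ^ d 2 := by
    rw [← pow_add, hm, ← two_mul, pow_mul, ← Complex.ofReal_pow, Real.sq_sqrt ht,
      Complex.ofReal_pow]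
  rw [h2, h3, mul_comm (h : ℂ), map_mul, Complex.conj_ofReal, conj_exp_I_mul]
  ring

theorem braidDeform_zero (a b : ℝ) {s : ℕ} (r l : ℕ) (hs : 0 < s) (z : ℂ) (h : ℝ) :
    braidDeform a b s r l 0 z h = ∏ j : Fin s, (z - strandZ a b s r l j h) := by
  rw [Fin.prod_univ_eq_prod_range (fun j => z - strandZ a b s r l j h), ← eval_braidPoly _ _ _ _ _ hs,
    MvPolynomial.eval_eq', braidDeform]
  simp [Fin.prod_univ_three, mul_assoc]

theorem contDiff_braidDeform (a b : ℝ) (s r l : ℕ) :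
    ContDiff ℝ 1 fun q : ℝ × ℂ × ℝ => braidDeform a b s r l q.1 q.2.1 q.2.2 := by
  unfold braidDeform
  have hz : ContDiff ℝ 1 fun q : ℝ × ℂ × ℝ => q.2.1 := contDiff_fst.comp contDiff_snd
  have hn : ContDiff ℝ 1 fun q : ℝ × ℂ × ℝ => 1 - q.1 * ‖q.2.1‖ ^ 2 :=
    contDiff_const.sub (contDiff_fst.mul (hz.norm_sq ℝ))
  have hh : ContDiff ℝ 1 fun q : ℝ × ℂ × ℝ => Complex.I * (q.2.2 : ℂ) :=
    contDiff_const.mul (Complex.ofRealCLM.contDiff.comp (contDiff_snd.comp contDiff_snd))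
  refine ContDiff.sum fun d _ => contDiff_const.mul ((hz.pow _).mul
    ((Complex.ofRealCLM.contDiff.comp (hn.pow _)).mul ((hh.cexp.pow _).mul (hh.neg.cexp.pow _))))

theorem braidDeform_add_two_pi (a b : ℝ) (s r l : ℕ) (t : ℝ) (z : ℂ) (h : ℝ) :
    braidDeform a b s r l t z (h + 2 * Real.pi) = braidDeform a b s r l t z h := by
  have e : Complex.exp (Complex.I * ((h + 2 * Real.pi : ℝ) : ℂ)) = Complex.exp (Complex.I * h) := by
    rw [← Complex.exp_periodic (Complex.I * h)]
    congr 1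
    push_cast
    ring
  simp only [braidDeform, ← conj_exp_I_mul, e]

/-- The relevant roots stay in a bounded set. -/
theorem norm_le_of_braidDeform_eq_zero {a b : ℝ} {s r l : ℕ} {t : ℝ} {z : ℂ} {h : ℝ} (ht : 0 ≤ t)
    (htz : t * ‖z‖ ^ 2 ≤ 1) (h0 : braidDeform a b s r l t z h = 0) :
    ‖z‖ ≤ max 1 (∑ d ∈ (braidPoly a b s r l).support, ‖(braidPoly a b s r l).coeff d‖) := by
  by_contra! hcon
  obtain ⟨h1, hC⟩ := max_lt_iff.mp hcon
  set S := (braidPoly a b s r l).support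
  have hmem : Finsupp.single 0 s ∈ S := by
    rw [MvPolynomial.mem_support_iff, coeff_braidPoly_single]
    exact one_ne_zero
  have hC0 : ∑ d ∈ S.erase (Finsupp.single 0 s), ‖(braidPoly a b s r l).coeff d‖ < ‖z‖ :=
    (Finset.sum_le_sum_of_subset_of_nonneg (Finset.erase_subset _ _)
      fun _ _ _ => norm_nonneg _).trans_lt hC
  rw [braidDeform, ← Finset.add_sum_erase _ _ hmem, coeff_braidPoly_single] at h0
  have hs : s ≠ 0 := by
    rintro rfl
    have he : S.erase (Finsupp.single 0 0) = ∅ := by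
      refine Finset.eq_empty_of_forall_notMem fun d hd => ?_
      obtain ⟨hne, hd⟩ := Finset.mem_erase.mp hd
      exact hne (eq_single_of_mem_support_braidPoly hd
        (Nat.le_zero.mp (le_of_mem_support_braidPoly hd)))
    rw [he] at h0
    simp at h0
  -- Cauchy's bound: each remaining monomial has degree at most s - 1 in z, where ‖z‖ > 1, and its
  -- other factors have norm at most 1 since 0 ≤ 1 - t‖z‖² ≤ 1.
  have hlead : ‖z‖ ^ s ≤ ∑ d ∈ S.erase (Finsupp.single 0 s),
      ‖(braidPoly a b s r l).coeff d‖ * ‖z‖ ^ (s - 1) := by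
    have h2 := eq_neg_of_add_eq_zero_left h0
    have h3 := congrArg norm h2
    simp only [Finsupp.single_eq_same, ne_eq, Fin.reduceEq, not_false_eq_true,
      Finsupp.single_eq_of_ne, one_mul, norm_neg, add_zero, Nat.zero_div, pow_zero,
      Complex.ofReal_one, mul_one, norm_pow] at h3
    rw [h3]
    refine (norm_sum_le _ _).trans (Finset.sum_le_sum fun d hd => ?_)
    obtain ⟨hne, hd⟩ := Finset.mem_erase.mp hd
    have hlt : d 0 < s := lt_of_le_of_ne (le_of_mem_support_braidPoly hd)
      fun h => hne (eq_single_of_mem_support_braidPoly hd h)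
    rw [norm_mul]
    refine mul_le_mul_of_nonneg_left ?_ (norm_nonneg _)
    have hn0 : 0 ≤ 1 - t * ‖z‖ ^ 2 := by linarith
    have hn1 : 1 - t * ‖z‖ ^ 2 ≤ 1 := by nlinarith [mul_nonneg ht (sq_nonneg ‖z‖)]
    have e1 : ‖Complex.exp (Complex.I * h)‖ = 1 := by
      rw [mul_comm, Complex.norm_exp_ofReal_mul_I]
    have e2 : ‖Complex.exp (-(Complex.I * h))‖ = 1 := by
      rw [← conj_exp_I_mul, RCLike.norm_conj, e1]
    rw [norm_mul, norm_mul, norm_mul, norm_pow, norm_pow, norm_pow, e1, e2, one_pow, one_pow,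
      mul_one, mul_one, Complex.norm_real, Real.norm_eq_abs, abs_of_nonneg (pow_nonneg hn0 _)]
    calc ‖z‖ ^ d 0 * (1 - t * ‖z‖ ^ 2) ^ ((d 1 + d 2) / 2) ≤ ‖z‖ ^ d 0 * 1 := by
          gcongr
          exact pow_le_one₀ hn0 hn1
      _ ≤ ‖z‖ ^ (s - 1) := by
          rw [mul_one]
          exact pow_le_pow_right₀ h1.le (by omega)
  rw [← Finset.sum_mul] at hlead
  have hz : 0 < ‖z‖ ^ (s - 1) := pow_pos (by linarith) _
  have h4 := mul_lt_mul_of_pos_right hC0 hz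
  rw [mul_pow_sub_one hs] at h4
  linarith

theorem simpleRootFamily_braidDeform {a b : ℝ} (ha : 0 < a) (hb : 0 < b) {s r l : ℕ} [NeZero s]
    (hl : 0 < l) (hsl : Nat.Coprime s l) :
    SimpleRootFamily (Fin s) (strandShift s r) (braidDeform a b s r l)
      fun j h => strandZ a b s r l j h where
  contDiff := contDiff_braidDeform a b s r l
  periodic := braidDeform_add_two_pi a b s r l
  continuous_root j := continuous_strandZ s r l j continuous_const continuous_const continuous_id
  root_perm j h := strandZ_add_two_pi a b s r l j h
  root j h := by
    rw [braidDeform_zero a b r l (NeZero.pos s)]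
    exact Finset.prod_eq_zero (Finset.mem_univ j) (sub_self _)
  simple j h := by
    have hinj := strandZ_injective ha.ne' hb.ne' (r := r) (NeZero.pos s) hl hsl h
    -- The derivative at a root is the product of its differences from the other roots, nonzero
    -- since the strands are disjoint.
    set Q : ℂ → ℂ := fun z => ∏ k ∈ Finset.univ.erase j, (z - strandZ a b s r l (k : Fin s) h)
    have hfun : (fun z => braidDeform a b s r l 0 z h)
        = fun z => (z - strandZ a b s r l j h) * Q z := by
      funext z
      rw [braidDeform_zero a b r l (NeZero.pos s), ← Finset.mul_prod_erase _ _ (Finset.mem_univ j)]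
    have hQ : Differentiable ℂ Q := by
      unfold Q
      fun_prop
    refine ⟨Q (strandZ a b s r l j h), Finset.prod_ne_zero_iff.mpr fun k hk => ?_, ?_⟩
    · exact sub_ne_zero.mpr fun he => (Finset.mem_erase.mp hk).1 (hinj he.symm)
    · rw [hfun]
      have := ((hasDerivAt_id (strandZ a b s r l j h)).sub_const (strandZ a b s r l j h)).mul
        (hQ (strandZ a b s r l j h)).hasDerivAt
      refine this.congr_deriv ?_
      simp

/-- For small parameter values every bounded root is close to a strand. -/
theorem exists_near_of_braidDeform_eq_zero (a b : ℝ) {s : ℕ} (r l : ℕ) [NeZero s] {η : ℝ}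
    (hη : 0 < η) (M : ℝ) : ∃ ε > 0, ∀ t, |t| < ε → ∀ z h, ‖z‖ ≤ M →
      braidDeform a b s r l t z h = 0 → ∃ j : Fin s, z ∈ Metric.closedBall (strandZ a b s r l j h) η
    := by
  have hc := (contDiff_braidDeform a b s r l).continuous
  -- The threshold η^s is a lower bound for the product of s distances when each is at least η.
  have h1 : ∀ᶠ t in 𝓝 (0 : ℝ), ∀ x ∈ Metric.closedBall (0 : ℂ) M ×ˢ Set.Icc 0 (2 * Real.pi),
      ‖braidDeform a b s r l t x.1 x.2 - braidDeform a b s r l 0 x.1 x.2‖ < η ^ s := by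
    refine ((isCompact_closedBall _ _).prod isCompact_Icc).eventually_forall_of_forall_eventually
      fun x _ => ?_
    have : Continuous fun y : ℝ × ℂ × ℝ => ‖braidDeform a b s r l y.1 y.2.1 y.2.2
        - braidDeform a b s r l 0 y.2.1 y.2.2‖ :=
      (hc.sub (hc.comp (continuous_const.prodMk continuous_snd))).norm
    refine this.continuousAt.eventually_lt continuousAt_const ?_
    simpa using pow_pos hη s
  obtain ⟨ε, hε, h2⟩ := Metric.eventually_nhds_iff.mp h1
  refine ⟨ε, hε, fun t ht z h hz h0 => ?_⟩
  obtain ⟨h₀, hh₀, n, rfl⟩ := exists_Icc_add_int_mul h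
  obtain ⟨τ, hτ⟩ := exists_perm_add_int_mul (T := Unit) (strandShift s r)
    (p := fun _ j h => strandZ a b s r l (j : Fin s) h)
    (fun _ j h => strandZ_add_two_pi a b s r l j h) h₀ n
  have hper : braidDeform a b s r l t z (h₀ + n * (2 * Real.pi)) = braidDeform a b s r l t z h₀ :=
    Function.Periodic.int_mul (f := braidDeform a b s r l t z)
      (braidDeform_add_two_pi a b s r l t z) n h₀
  rw [hper] at h0
  have h3 := h2 (by simpa using ht) (z, h₀) ⟨by simpa using hz, hh₀⟩
  simp only [h0, zero_sub, norm_neg, braidDeform_zero a b r l (NeZero.pos s), norm_prod] at h3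
  by_contra! hcon
  have h4 : ∀ j : Fin s, η ≤ ‖z - strandZ a b s r l j h₀‖ := by
    intro j
    have h5 := hcon (τ⁻¹ j)
    have h6 := hτ () (τ⁻¹ j)
    rw [← Equiv.Perm.mul_apply, mul_inv_cancel, Equiv.Perm.one_apply] at h6
    rw [h6, mem_closedBall_iff_norm, not_le] at h5
    exact h5.le
  have h5 := Finset.prod_le_prod (s := Finset.univ) (f := fun _ : Fin s => η)
    (fun _ _ => hη.le) fun j _ => h4 j
  rw [Finset.prod_const, Finset.card_univ, Fintype.card_fin] at h5
  linarith

/-! ### The Jacobian -/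

theorem hasFDerivAt_eval (p : MvPolynomial (Fin 4) ℝ) (x : Fin 4 → ℝ) :
    HasFDerivAt (fun y => MvPolynomial.eval y p)
      (∑ j, MvPolynomial.eval x (MvPolynomial.pderiv j p) •
        (ContinuousLinearMap.proj j : (Fin 4 → ℝ) →L[ℝ] ℝ)) x := by
  induction p using MvPolynomial.induction_on with
  | C c => simpa using hasFDerivAt_const c x
  | add p q hp hq =>
    simp only [map_add, add_smul, Finset.sum_add_distrib]
    exact hp.add hq
  | mul_X p i hp =>
    have h1 : HasFDerivAt (fun y : Fin 4 → ℝ => MvPolynomial.eval y (MvPolynomial.X i))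
        (ContinuousLinearMap.proj i : (Fin 4 → ℝ) →L[ℝ] ℝ) x := by
      simpa using hasFDerivAt_apply i x
    have h2 := hp.mul h1
    simp only [map_mul]
    refine h2.congr_fderiv ?_
    ext w
    simp only [MvPolynomial.eval_X, MvPolynomial.pderiv_mul, MvPolynomial.pderiv_X, map_add,
      map_mul, add_apply, smul_apply, sum_apply, ContinuousLinearMap.proj_apply, smul_eq_mul,
      add_mul, Finset.sum_add_distrib, Finset.mul_sum]
    rw [add_comm]
    congr 1
    · exact Finset.sum_congr rfl fun j _ => by ring
    · rw [Finset.sum_eq_single i]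
      · simp
      · intro j _ hj
        simp [hj.symm]
      · simp

/-- The Jacobian matrix represents the derivative. -/
theorem hasFDerivAt_polyValue (P : Fin 2 → MvPolynomial (Fin 4) ℝ) (x : Fin 4 → ℝ) :
    ∃ L : (Fin 4 → ℝ) →L[ℝ] ℂ, HasFDerivAt (polyValue P) L x ∧
      ∀ w, L w = ⟨(polyJacobian P x).mulVec w 0, (polyJacobian P x).mulVec w 1⟩ := by
  have h0 := hasFDerivAt_eval (P 0) x
  have h1 := hasFDerivAt_eval (P 1) x
  have h2 := (Complex.ofRealCLM.hasFDerivAt.comp x h0).add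
    ((Complex.ofRealCLM.hasFDerivAt.comp x h1).mul_const Complex.I)
  have e : polyValue P = fun y => ((MvPolynomial.eval y (P 0) : ℝ) : ℂ)
      + ((MvPolynomial.eval y (P 1) : ℝ) : ℂ) * Complex.I := by
    funext y
    rw [polyValue, Complex.mk_eq_add_mul_I]
  refine ⟨_, by rw [e]; exact h2, fun w => ?_⟩
  rw [Complex.mk_eq_add_mul_I]
  simp [Matrix.mulVec, dotProduct, polyJacobian, mul_comm]

/-- By the chain rule, if P restricted to a parametrized surface already has surjective derivative,
so has P. -/
theorem not_isSingularPoint_of_surjective {P : Fin 2 → MvPolynomial (Fin 4) ℝ} {x : Fin 4 → ℝ}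
    {γ : ℂ → Fin 4 → ℝ} {z : ℂ} (hγ : DifferentiableAt ℝ γ z) (hx : γ z = x) {L : ℂ →L[ℝ] ℂ}
    (hL : HasFDerivAt (fun z => polyValue P (γ z)) L z) (hs : Function.Surjective L) :
    ¬ IsSingularPoint P x := by
  subst hx
  obtain ⟨L', hL', hw⟩ := hasFDerivAt_polyValue P (γ z)
  have he := hL.unique (hL'.comp z hγ.hasFDerivAt)
  have hsurj : Function.Surjective (polyJacobian P (γ z)).mulVecLin := by
    intro y
    obtain ⟨w, hw'⟩ := hs ⟨y 0, y 1⟩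
    refine ⟨fderiv ℝ γ z w, ?_⟩
    rw [he, ContinuousLinearMap.comp_apply, hw, Complex.mk.injEq] at hw'
    ext i
    fin_cases i
    · exact hw'.1
    · exact hw'.2
  rw [IsSingularPoint, Matrix.rank, LinearMap.range_eq_top.mpr hsurj, finrank_top]
  simp

/-! ### The zero set on small spheres -/

/-- The condition δ‖z‖ ≤ 1 says that δ²z is the first coordinate of a point of the sphere; strict
inequality keeps the roots off the circle v = 0. -/
theorem exists_roots_on_small_spheres {a b : ℝ} (ha : 0 < a) (hb : 0 < b) {s r l : ℕ} [NeZero s]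
    (hl : 0 < l) (hsl : Nat.Coprime s l) :
    ∃ ε > 0, ∀ δ, 0 < δ → δ < ε → δ * (a + b) < 1 / 4 ∧ ∃ p : Fin s → ℝ → ℂ,
      AmbientIsotopicIn (sphere3 δ) (fiberedSet δ fun j h => (δ : ℂ) ^ 2 * p j h)
        (fiberedSet δ fun (j : Fin s) h => (δ : ℂ) ^ 2 * strandZ a b s r l j h) ∧
      (∀ z h, δ * ‖z‖ ≤ 1 → (braidDeform a b s r l (δ ^ 2) z h = 0 ↔ ∃ j, z = p j h)) ∧
      ∀ j h, δ * ‖p j h‖ < 1 ∧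
        Function.Surjective (fderiv ℝ (fun z => braidDeform a b s r l (δ ^ 2) z h) (p j h)) := by
  have hs : (0 : ℝ) < s := by exact_mod_cast NeZero.pos s
  have H := simpleRootFamily_braidDeform (r := r) ha hb hl hsl
  obtain ⟨η, hη, hder⟩ := H.exists_fderiv_near
  obtain ⟨κ, hsep, hκ⟩ := ((eventually_separated (strandShift s r) H.continuous_root H.root_perm
    fun h => strandZ_injective ha.ne' hb.ne' (NeZero.pos s) hl hsl h).and self_mem_nhdsWithin).exists
  have hκ : 0 < κ := hκ
  -- η/2 leaves the room that `exists_roots` asks for; κ/(2s) is the closeness that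
  -- `ambientIsotopicIn_of_close` needs for s strands with separation κ.
  set η' := min (η / 2) (κ / (2 * s))
  have hη' : 0 < η' := lt_min (by positivity) (by positivity)
  have hη'κ : η' * (2 * s) ≤ κ := (le_div_iff₀ (by positivity)).mp (min_le_right _ _)
  obtain ⟨ε₁, hε₁, hroots⟩ := H.exists_roots hη'
    ((min_le_left _ _).trans_lt (by linarith)) hder
  set M := max 1 (∑ d ∈ (braidPoly a b s r l).support, ‖(braidPoly a b s r l).coeff d‖)
  obtain ⟨ε₂, hε₂, hnear⟩ := exists_near_of_braidDeform_eq_zero a b r l (s := s) hη' M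
  have hc : 0 < 1 / (4 * (a + b + κ)) := by positivity
  -- δ < 1 gives δ² < δ, so t = δ² obeys the bounds η, ε₁ and ε₂. The second entry gives δ(a + b +
  -- κ) < 1/4, which keeps the strands and their bumps inside the disc.
  refine ⟨min (min 1 (1 / (4 * (a + b + κ)))) (min η (min ε₁ ε₂)), by positivity,
    fun δ hδ hδε => ?_⟩
  simp only [lt_min_iff] at hδε
  obtain ⟨⟨hδ1, hδc⟩, hδη, hδ₁, hδ₂⟩ := hδε
  have hsq : |δ ^ 2| < δ := by
    rw [abs_of_nonneg (sq_nonneg δ)]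
    nlinarith
  have hδc : δ * (a + b + κ) < 1 / 4 := by
    rw [lt_div_iff₀ (by positivity)] at hδc
    linarith
  have hδκ : 0 < δ * κ := by positivity
  obtain ⟨p, hpc, hpσ, hp, hpu⟩ := hroots (δ ^ 2) (hsq.trans hδ₁)
  have hs1 : (1 : ℝ) ≤ s := by exact_mod_cast NeZero.pos s
  have hpn : ∀ j h, δ * ‖p j h‖ < 1 := by
    intro j h
    have h1 := mem_closedBall_iff_norm.mp (hp j h).1
    have h2 := norm_strandZ_le ha.le hb.le s r hl j h
    have h3 := norm_sub_norm_le (p j h) (strandZ a b s r l j h)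
    have h4 : ‖p j h‖ ≤ a + b + κ := by nlinarith
    nlinarith
  refine ⟨by linarith, p, ?_, fun z h hz => ⟨fun h0 => ?_, ?_⟩, fun j h => ⟨hpn j h, ?_⟩⟩
  · refine AmbientIsotopicIn.symm (ambientIsotopicIn_of_close (η := δ ^ 2 * κ) hδ (by positivity)
      (strandShift s r) (fun j => continuous_const.mul (H.continuous_root j))
      (fun j => continuous_const.mul (hpc j)) (fun j h => by rw [H.root_perm])
      (fun j h => by rw [hpσ]) ?_ ?_ ?_)
    · intro h j k hjk
      rw [← mul_sub, norm_mul, ← Complex.ofReal_pow, Complex.norm_real, Real.norm_eq_abs,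
        abs_of_nonneg (sq_nonneg δ)]
      exact mul_le_mul_of_nonneg_left (hsep h j k hjk) (sq_nonneg δ)
    · intro h j
      have h2 := norm_strandZ_le ha.le hb.le s r hl j h
      rw [norm_mul, ← Complex.ofReal_pow, Complex.norm_real, Real.norm_eq_abs,
        abs_of_nonneg (sq_nonneg δ)]
      have h3 : δ * (δ * (a + b + κ)) ≤ δ * 1 := by gcongr; linarith
      nlinarith [mul_le_mul_of_nonneg_left h2 (sq_nonneg δ)]
    · intro h j
      have h1 := mem_closedBall_iff_norm.mp (hp j h).1
      rw [← mul_sub, norm_mul, ← Complex.ofReal_pow, Complex.norm_real, Real.norm_eq_abs,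
        abs_of_nonneg (sq_nonneg δ), Fintype.card_fin, mul_assoc]
      refine mul_le_mul_of_nonneg_left (le_trans ?_ hη'κ) (sq_nonneg δ)
      gcongr
  · have hz2 : δ ^ 2 * ‖z‖ ^ 2 ≤ 1 := by
      rw [← mul_pow]
      exact pow_le_one₀ (by positivity) hz
    obtain ⟨j, hj⟩ := hnear (δ ^ 2) (hsq.trans hδ₂) z h
      (norm_le_of_braidDeform_eq_zero (sq_nonneg δ) hz2 h0) h0
    exact ⟨j, hpu j h z hj h0⟩
  · rintro ⟨j, rfl⟩
    exact (hp j h).2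
  · refine SimpleRootFamily.surjective_fderiv (hder (δ ^ 2) (hsq.trans hδη) j h _ ?_)
    exact Metric.closedBall_subset_closedBall ((min_le_left _ _).trans (by linarith)) (hp j h).1

theorem isNodalPoint_iff (P : Fin 2 → MvPolynomial (Fin 4) ℝ) (x : Fin 4 → ℝ) :
    IsNodalPoint P x ↔ polyValue P x = 0 := by
  simp [IsNodalPoint, polyValue, Complex.ext_iff, Fin.forall_fin_two]

theorem norm_sq_mul {δ : ℝ} (hδ : 0 < δ) (z : ℂ) : ‖(δ : ℂ) ^ 2 * z‖ = δ * (δ * ‖z‖) := by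
  rw [norm_mul, norm_pow, Complex.norm_real, Real.norm_eq_abs, abs_of_pos hδ]
  ring

/-- Here ρ = δ, so u/ρ² = z and v/ρ = √(1 - δ²‖z‖²) e^{ih}; this is why the disc is parametrized by
δ²z. -/
theorem polyValue_spherePoint {a b : ℝ} {s r l N : ℕ} (hs : 0 < s) (hr : Even r)
    {P : Fin 2 → MvPolynomial (Fin 4) ℝ}
    (hP : ∀ u v : ℂ, (u, v) ≠ (0, 0) → polyValue P (realCoords u v)
      = (rho u v : ℂ) ^ N * braidFun a b s r l (u / (rho u v : ℂ) ^ 2) (v / rho u v))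
    {δ : ℝ} (hδ : 0 < δ) {z : ℂ} (hz : δ * ‖z‖ ≤ 1) (h : ℝ) :
    polyValue P (realCoords (spherePoint δ ((δ : ℂ) ^ 2 * z) h).1
        (spherePoint δ ((δ : ℂ) ^ 2 * z) h).2)
      = (δ : ℂ) ^ N * braidDeform a b s r l (δ ^ 2) z h := by
  have hδ' : (δ : ℂ) ≠ 0 := by exact_mod_cast hδ.ne'
  have hle : ‖(δ : ℂ) ^ 2 * z‖ ≤ δ := by
    rw [norm_sq_mul hδ]
    nlinarith
  have hρ : rho (spherePoint δ ((δ : ℂ) ^ 2 * z) h).1 (spherePoint δ ((δ : ℂ) ^ 2 * z) h).2 = δ :=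
    spherePoint_mem hδ.le hle h
  have hz2 : 0 ≤ 1 - δ ^ 2 * ‖z‖ ^ 2 := by
    rw [← mul_pow, sub_nonneg]
    exact pow_le_one₀ (by positivity) hz
  rw [hP, hρ, braidDeform_eq_braidFun a b l hs hr hz2]
  · congr 2
    · simp only [spherePoint]
      field_simp
    · have e : δ ^ 2 - ‖(δ : ℂ) ^ 2 * z‖ ^ 2 = δ ^ 2 * (1 - δ ^ 2 * ‖z‖ ^ 2) := by
        rw [norm_sq_mul hδ]
        ring
      simp only [spherePoint]
      rw [e, Real.sqrt_mul (sq_nonneg δ), Real.sqrt_sq hδ.le]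
      push_cast
      field_simp
  · intro h0
    simp only [Prod.mk.injEq] at h0
    rw [h0.1, h0.2] at hρ
    simp [rho] at hρ
    exact hδ.ne hρ

/-- The inequality is strict because the square root is not differentiable at 0. -/
theorem differentiableAt_realCoords_spherePoint {δ : ℝ} {z : ℂ}
    (hz : ‖(δ : ℂ) ^ 2 * z‖ < δ) (h : ℝ) :
    DifferentiableAt ℝ (fun z : ℂ => realCoords (spherePoint δ ((δ : ℂ) ^ 2 * z) h).1
      (spherePoint δ ((δ : ℂ) ^ 2 * z) h).2) z := by
  have h1 : DifferentiableAt ℝ (fun z : ℂ => (δ : ℂ) ^ 2 * z) z :=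
    (differentiableAt_const _).mul differentiableAt_id
  have h2 : DifferentiableAt ℝ (fun z : ℂ => √(δ ^ 2 - ‖(δ : ℂ) ^ 2 * z‖ ^ 2)) z := by
    refine DifferentiableAt.sqrt ((differentiableAt_const _).sub (h1.norm_sq ℝ)) ?_
    have := norm_nonneg ((δ : ℂ) ^ 2 * z)
    nlinarith
  have h3 : DifferentiableAt ℝ (fun z : ℂ => ((√(δ ^ 2 - ‖(δ : ℂ) ^ 2 * z‖ ^ 2) : ℝ) : ℂ)
      * Complex.exp (h * Complex.I)) z :=
    (Complex.ofRealCLM.differentiableAt.comp z h2).mul (differentiableAt_const _)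
  rw [differentiableAt_pi]
  intro i
  fin_cases i
  · exact Complex.reCLM.differentiableAt.comp z h1
  · exact Complex.imCLM.differentiableAt.comp z h1
  · exact Complex.reCLM.differentiableAt.comp z h3
  · exact Complex.imCLM.differentiableAt.comp z h3

theorem exists_eq_spherePoint {δ : ℝ} (hδ : 0 < δ) {x : ℂ × ℂ} (hx : x ∈ sphere3 δ) :
    ∃ z h, δ * ‖z‖ ≤ 1 ∧ x = spherePoint δ ((δ : ℂ) ^ 2 * z) h := by
  have hδ' : (δ : ℂ) ≠ 0 := by exact_mod_cast hδ.ne'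
  have e : (δ : ℂ) ^ 2 * (x.1 / (δ : ℂ) ^ 2) = x.1 := by field_simp
  refine ⟨x.1 / (δ : ℂ) ^ 2, x.2.arg, ?_, ?_⟩
  · have h1 := norm_fst_le_of_mem_sphere3 hδ.le hx
    rw [← e, norm_sq_mul hδ] at h1
    exact le_of_mul_le_mul_left (by linarith) hδ
  · rw [e, spherePoint_arg hδ.le hx]

/-! ### The main theorem -/

theorem mainTheorem5 (s r l : ℕ) (hs : 0 < s) (hr : 0 < r) (hl : 0 < l)
    (hsl : Nat.Coprime s l) (hreven : Even r) (a b : ℝ) (ha : 0 < a) (hb : 0 < b) :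
    (∀ u v : ℂ, (u, v) ≠ (0, 0) →
      rescaledFun a b s r l u v =
        (rho u v : ℂ) ^ (s + (braidPoly (rho u v * a) (rho u v * b) s r l).totalDegree)
          * braidFun a b s r l (u / (rho u v : ℂ) ^ 2) (v / rho u v)) ∧
    ∃ (n : ℕ) (P : Fin 2 → MvPolynomial (Fin 4) ℝ),
      (∀ u v : ℂ, (u, v) ≠ (0, 0) →
        (⟨MvPolynomial.eval (realCoords u v) (P 0), MvPolynomial.eval (realCoords u v) (P 1)⟩ : ℂ)
          = (rho u v : ℂ) ^ n * rescaledFun a b s r l u v) ∧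
      IsWeaklyIsolatedSingularity P 0 ∧
      ∃ ε : ℝ, 0 < ε ∧ ∀ δ : ℝ, 0 < δ → δ < ε →
        ∀ a' b' R : ℝ, 0 < a' → 0 < b' → a' < R →
          AmbientIsotopicIn (sphere3 δ)
            {p : ℂ × ℂ | IsNodalPoint P (realCoords p.1 p.2)}
            (lemniscateLink δ a' b' R s r l) := by
  have : NeZero s := ⟨hs.ne'⟩
  refine ⟨fun u v h => rescaledFun_eq a b s r l h, ?_⟩
  obtain ⟨P, hP0, hP1, hP⟩ := exists_polyValue_eq a b l hs hreven
  obtain ⟨ε, hε, hsmall⟩ := exists_roots_on_small_spheres (r := r) ha hb hl hsl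
  have hnodal : ∀ {δ : ℝ}, 0 < δ → ∀ {z : ℂ}, δ * ‖z‖ ≤ 1 → ∀ h,
      (IsNodalPoint P (realCoords (spherePoint δ ((δ : ℂ) ^ 2 * z) h).1
        (spherePoint δ ((δ : ℂ) ^ 2 * z) h).2) ↔ braidDeform a b s r l (δ ^ 2) z h = 0) := by
    intro δ hδ z hz h
    have hδ' : (δ : ℂ) ≠ 0 := by exact_mod_cast hδ.ne'
    rw [isNodalPoint_iff, polyValue_spherePoint hs hreven hP hδ hz]
    simp [hδ']
  -- P carries ρ^{2(s+D+1)} and F carries ρ^{s+D}; the quotient is ρ^{s+D+2}.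
  refine ⟨s + (braidPoly a b s r l).totalDegree + 2, P, fun u v h => ?_, ⟨hP0, hP1, ?_⟩, ε, hε,
    fun δ hδ hδε a' b' R ha' hb' haR => ?_⟩
  · refine (hP u v h).trans ?_
    rw [rescaledFun_eq a b s r l h, totalDegree_braidPoly_mul (rho_pos h).ne', ← mul_assoc,
      ← pow_add]
    congr 2
    ring
  · have hcont : Continuous fun y : Fin 4 → ℝ => rho ⟨y 0, y 1⟩ ⟨y 2, y 3⟩ := by
      simp only [rho, Complex.sq_norm, Complex.normSq_mk]
      fun_prop
    have h0 : ∀ᶠ y in 𝓝 (0 : Fin 4 → ℝ), rho ⟨y 0, y 1⟩ ⟨y 2, y 3⟩ < ε :=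
      hcont.continuousAt.eventually_lt continuousAt_const (by
        simpa [rho, Complex.sq_norm, Complex.normSq_mk] using hε)
    filter_upwards [h0] with y hy hsing hnod
    by_contra hne
    have hy' : realCoords ⟨y 0, y 1⟩ ⟨y 2, y 3⟩ = y := by
      ext i
      fin_cases i <;> rfl
    have huv : ((⟨y 0, y 1⟩, ⟨y 2, y 3⟩) : ℂ × ℂ) ≠ (0, 0) := by
      intro h
      simp only [Prod.mk.injEq] at h
      rw [h.1, h.2] at hy'
      refine hne (hy'.symm.trans ?_)
      ext i
      fin_cases i <;> rfl
    set δ := rho ⟨y 0, y 1⟩ ⟨y 2, y 3⟩ with hδdef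
    have hδ : 0 < δ := rho_pos huv
    obtain ⟨z, h, hz, hx⟩ := exists_eq_spherePoint (x := (⟨y 0, y 1⟩, ⟨y 2, y 3⟩)) hδ rfl
    have hyz : realCoords (spherePoint δ ((δ : ℂ) ^ 2 * z) h).1
        (spherePoint δ ((δ : ℂ) ^ 2 * z) h).2 = y := by
      rw [← hx, hy']
    rw [← hyz, hnodal hδ hz] at hnod
    obtain ⟨-, p, -, hroot, hp⟩ := hsmall δ hδ hy
    obtain ⟨j, rfl⟩ := (hroot z h hz).mp hnod
    obtain ⟨hlt, hsurj⟩ := hp j h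
    have hlt' : ‖(δ : ℂ) ^ 2 * p j h‖ < δ := by
      rw [norm_sq_mul hδ]
      nlinarith
    have hδ' : (δ : ℂ) ≠ 0 := by exact_mod_cast hδ.ne'
    -- With h fixed, P along the sphere is a nonzero constant times `braidDeform`, so the two
    -- z-directions alone give the Jacobian rank 2.
    have hder := ((simpleRootFamily_braidDeform (r := r) ha hb hl hsl).hasFDerivAt
      (δ ^ 2) (p j h) h).const_smul
        ((δ : ℂ) ^ (2 * (s + (braidPoly a b s r l).totalDegree + 1)))
    have hev : ∀ᶠ z in 𝓝 (p j h), δ * ‖z‖ < 1 :=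
      (continuous_const.mul continuous_norm).continuousAt.eventually_lt continuousAt_const hlt
    refine not_isSingularPoint_of_surjective
      (differentiableAt_realCoords_spherePoint hlt' h) hyz (hder.congr_of_eventuallyEq ?_) ?_ hsing
    · filter_upwards [hev] with z hz
      exact polyValue_spherePoint hs hreven hP hδ hz.le h
    · intro w
      obtain ⟨w', hw'⟩ := hsurj (((δ : ℂ) ^ (2 * (s + (braidPoly a b s r l).totalDegree + 1)))⁻¹ * w)
      refine ⟨w', ?_⟩
      rw [smul_apply, hw', smul_eq_mul, mul_inv_cancel_left₀ (pow_ne_zero _ hδ')]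
  · obtain ⟨hab, p, hiso, hroot, hp⟩ := hsmall δ hδ hδε
    -- The nodal set and the swept strands need only agree on the sphere of radius δ.
    refine AmbientIsotopicIn.congr_left (hiso.trans
      (ambientIsotopicIn_lemniscateLink hδ ha hb hab hl hsl ha' hb' haR)) fun x hx => ?_
    constructor
    · intro hn
      obtain ⟨z, h, hz, rfl⟩ := exists_eq_spherePoint hδ hx
      obtain ⟨j, rfl⟩ := (hroot z h hz).mp ((hnodal hδ hz h).mp hn)
      exact ⟨j, h, rfl⟩
    · rintro ⟨j, h, rfl⟩
      exact (hnodal hδ (hp j h).1.le h).mpr ((hroot _ h (hp j h).1.le).mpr ⟨j, rfl⟩)
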